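/- Let $k$ be a field of prime characteristic $p$, let $n,d\ge 0$ be integers with $p\ge\max(n,2d)$, and let $U_n$ be the algebraic group over $k$ of $n\times n$ upper triangular unipotent matrices, with coordinate Hopf algebra $A_n=k[x_{ij}:1\le i<j\le n]$ and generic element $g=1+\sum_{i<j}x_{ij}\varepsilon_{ij}$. Let $\mathfrak u_n$ be its Lie algebra of strictly upper triangular matrices. A representation of $U_n$ on a vector space $V$ is a (right) $A_n$-comodule structure $V\to V\otimes A_n$; when $V$ is finite-dimensional it is identified with its matrix formula, an element of $\operatorname{End}(V)\otimes A_n$. A morphism of representations is a linear map commuting with the coactions. For $M\in\operatorname{End}(V)\otimes A_n$ let $M^{[q]}$ be obtained from $M$ by replacing every variable $x_{ij}$ by $x_{ij}^q$ (scalars unchanged), and let $\log(g)=\sum_{j=1}^{n-1}\frac{(-1)^{j-1}}{j}(g-1)^j$. Call $\Phi=\Phi_0\Phi_1\cdots\Phi_m$ a decomposition of a representation $\Phi$ on $V$ if $$\Phi_i=\bigl(e^{\phi_i(\log g)}\bigr)^{[p^i]}\qquad(0\le i\le m)$$ for Lie algebra homomorphisms $\phi_0,\dots,\phi_m:\mathfrak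 u_n\to\mathfrak{gl}(V)$ such that every $\phi_i(X)$ is nilpotent and $\phi_i(X)$ commutes with $\phi_j(Y)$ for all $i\ne j$ and $X,Y\in\mathfrak u_n$. Theorem. Let $\Phi,\Psi$ be representations of $U_n$ on $k$-vector spaces $V,W$ of dimension at most $d$. Then, for some $m$, both have decompositions $\Phi=\Phi_0\cdots\Phi_m$ and $\Psi=\Psi_0\cdots\Psi_m$. Moreover, for any $m$ and any such decompositions, all $\Phi_i$ and $\Psi_i$ are representations of $U_n$, and a linear map $f:V\to W$ is a morphism $\Phi\to\Psi$ if and only if it is a morphism $\Phi_i\to\Psi_i$ for every $i=0,\dots,m$. -/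

import Mathlib

open scoped TensorProduct

attribute [local instance 100] LieRing.ofAssociativeRing

namespace UnipotentRep

/-- Pairs `(i, j)` with `i < j`: the positions of the coordinates `x_{ij}` on `U_n`. -/
abbrev Pos (n : ℕ) : Type := {ij : Fin n × Fin n // ij.1 < ij.2}

/-- The coordinate ring `A_n = k[x_{ij} : i < j]` of `U_n`. -/
abbrev CoordRing (k : Type*) [Field k] (n : ℕ) : Type _ := MvPolynomial (Pos n) k

/-- The generic element `g` of `U_n`: ones on the diagonal, `x_{ij}` at the places `i < j`. -/
noncomputable def generic (k : Type*) [Field k] (n : ℕ) :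
    Matrix (Fin n) (Fin n) (CoordRing k n) :=
  Matrix.of fun i j => if h : i < j then MvPolynomial.X ⟨(i, j), h⟩ else if i = j then 1 else 0

/-- The comultiplication
`x_{ij} ↦ 1 ⊗ x_{ij} + ∑_{i < l < j} x_{il} ⊗ x_{lj} + x_{ij} ⊗ 1`. -/
noncomputable def comul (k : Type*) [Field k] (n : ℕ) :
    CoordRing k n →ₐ[k] CoordRing k n ⊗[k] CoordRing k n :=
  MvPolynomial.aeval fun r : Pos n =>
    1 ⊗ₜ[k] MvPolynomial.X r +
      ∑ l ∈ Finset.Ioo r.1.1 r.1.2, generic k n r.1.1 l ⊗ₜ[k] generic k n l r.1.2 +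
      MvPolynomial.X r ⊗ₜ[k] 1

/-- The counit `x_{ij} ↦ 0`. -/
noncomputable def counit (k : Type*) [Field k] (n : ℕ) : CoordRing k n →ₐ[k] k :=
  MvPolynomial.aeval fun _ => 0

/-- A `k`-linear map `V → V ⊗ A_n` is a representation of the algebraic group `U_n` on `V` if it
is a (right) comodule structure over `A_n`. -/
structure IsRepresentation {k : Type*} [Field k] {n : ℕ} {V : Type*} [AddCommGroup V] [Module k V]
    (ρ : V →ₗ[k] V ⊗[k] CoordRing k n) : Prop where
  coassoc : (TensorProduct.assoc k V (CoordRing k n) (CoordRing k n)).toLinearMap ∘ₗ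
      LinearMap.rTensor (CoordRing k n) ρ ∘ₗ ρ =
    LinearMap.lTensor V (comul k n).toLinearMap ∘ₗ ρ
  counit_comp : (TensorProduct.rid k V).toLinearMap ∘ₗ
      LinearMap.lTensor V (counit k n).toLinearMap ∘ₗ ρ = LinearMap.id

/-- `f : V → W` is a morphism from the coaction `ρ` on `V` to the coaction `σ` on `W`. -/
def IsMorphism {k : Type*} [Field k] {n : ℕ} {V W : Type*} [AddCommGroup V] [Module k V]
    [AddCommGroup W] [Module k W] (f : V →ₗ[k] W)
    (ρ : V →ₗ[k] V ⊗[k] CoordRing k n) (σ : W →ₗ[k] W ⊗[k] CoordRing k n) : Prop :=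
  LinearMap.rTensor (CoordRing k n) f ∘ₗ ρ = σ ∘ₗ f

/-- The Lie algebra `u_n` of strictly upper triangular `n × n` matrices, with the commutator. -/
def strictUpper (k : Type*) [Field k] (n : ℕ) : LieSubalgebra k (Matrix (Fin n) (Fin n) k) where
  carrier := {M | ∀ i j, j ≤ i → M i j = 0}
  zero_mem' := fun _ _ _ => rfl
  add_mem' := fun {M N} hM hN i j h => by simp [hM i j h, hN i j h]
  smul_mem' := fun c M hM i j h => by simp [hM i j h]
  lie_mem' := fun {M N} hM hN i j h => by
    have key : ∀ P Q : Matrix (Fin n) (Fin n) k, (∀ i j, j ≤ i → P i j = 0) →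
        (∀ i j, j ≤ i → Q i j = 0) → (P * Q) i j = 0 := by
      intro P Q hP hQ
      rw [Matrix.mul_apply]
      refine Finset.sum_eq_zero fun l _ => ?_
      rcases le_total l i with hl | hl
      · rw [hP i l hl, zero_mul]
      · rw [hQ l j (h.trans hl), mul_zero]
    simp [Ring.lie_def, key M N hM hN, key N M hN hM]

/-- The matrix unit `ε_{ij}`, `i < j`, as an element of `u_n`. -/
def matrixUnit (k : Type*) [Field k] {n : ℕ} (r : Pos n) : strictUpper k n :=
  ⟨Matrix.single r.1.1 r.1.2 1, fun i j h => by
    rw [Matrix.single_apply, if_neg]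
    rintro ⟨rfl, rfl⟩
    exact absurd r.2 (not_lt.mpr h)⟩

/-- `log g = ∑_{j=1}^{n-1} (-1)^{j-1} / j (g - 1)^j` for the generic element `g` of `U_n`. -/
noncomputable def logGeneric (k : Type*) [Field k] (n : ℕ) :
    Matrix (Fin n) (Fin n) (CoordRing k n) :=
  ∑ j ∈ Finset.Icc 1 (n - 1), ((-1 : k) ^ (j - 1) * (j : k)⁻¹) • (generic k n - 1) ^ j

/-- `φ(log g) ∈ gl(V) ⊗ A_n`, the value at `log g` of the `A_n`-linear extension of `φ`; here
`log g = ∑_{i<j} (log g)_{ij} ε_{ij}`. -/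
noncomputable def atLog {k : Type*} [Field k] {n : ℕ} {V : Type*} [AddCommGroup V] [Module k V]
    (φ : strictUpper k n →ₗ⁅k⁆ Module.End k V) : Module.End k V ⊗[k] CoordRing k n :=
  ∑ r : Pos n, φ (matrixUnit k r) ⊗ₜ[k] logGeneric k n r.1.1 r.1.2

/-- The exponential series `∑ N^j / j!` of a nilpotent element of a `k`-algebra; it stops at the
nilpotency class of `N`. -/
noncomputable def nilExp (k : Type*) [Field k] {B : Type*} [Ring B] [Algebra k B] (N : B) : B :=
  ∑ j ∈ Finset.range (nilpotencyClass N), ((j.factorial : k)⁻¹) • N ^ j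

/-- `M ↦ M^{[q]}`: every variable `x_{ij}` is replaced by `x_{ij}^q`, scalars are unchanged. -/
noncomputable def powVars (k : Type*) [Field k] (n : ℕ) (V : Type*) [AddCommGroup V] [Module k V]
    (q : ℕ) : Module.End k V ⊗[k] CoordRing k n →ₐ[k] Module.End k V ⊗[k] CoordRing k n :=
  Algebra.TensorProduct.map (AlgHom.id k (Module.End k V)) (MvPolynomial.expand q)

/-- The linear map `V → V ⊗ A_n` with matrix formula `Θ`: for `Θ = ∑ T ⊗ a` it sends `v` to
`∑ T v ⊗ a`. -/
noncomputable def toCoaction {k : Type*} [Field k] {n : ℕ} {V : Type*} [AddCommGroup V]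
    [Module k V] (Θ : Module.End k V ⊗[k] CoordRing k n) : V →ₗ[k] V ⊗[k] CoordRing k n :=
  TensorProduct.rTensorHomToHomRTensor (RingHom.id k) V V (CoordRing k n) Θ

/-- The factor `(e^{φ_i(log g)})^{[p^i]}`. -/
noncomputable def factor {k : Type*} [Field k] {n : ℕ} {V : Type*} [AddCommGroup V] [Module k V]
    (p : ℕ) {m : ℕ} (φ : Fin (m + 1) → (strictUpper k n →ₗ⁅k⁆ Module.End k V)) (i : Fin (m + 1)) :
    Module.End k V ⊗[k] CoordRing k n :=
  powVars k n V (p ^ (i : ℕ)) (nilExp k (atLog (φ i)))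

/-- `φ_0, …, φ_m : u_n → gl(V)` are Lie algebra homomorphisms with nilpotent values that commute
with each other, and `Φ(g) = e^{φ_0(log g)} (e^{φ_1(log g)})^{[p]} ⋯ (e^{φ_m(log g)})^{[p^m]}`. -/
structure IsDecomposition {k : Type*} [Field k] {n : ℕ} {V : Type*} [AddCommGroup V] [Module k V]
    (p : ℕ) {m : ℕ} (φ : Fin (m + 1) → (strictUpper k n →ₗ⁅k⁆ Module.End k V))
    (Φ : V →ₗ[k] V ⊗[k] CoordRing k n) : Prop where
  nilpotent : ∀ i X, IsNilpotent (φ i X)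
  commute : ∀ i j, i ≠ j → ∀ X Y, Commute (φ i X) (φ j Y)
  eq_prod : Φ = toCoaction (List.ofFn fun i => factor p φ i).prod

end UnipotentRep

/-! In characteristic `p` the differential of a representation determines it only up to functions of
the `x_{ij}^p`. The proof removes one exponential factor at a time and passes to a Frobenius twist
of smaller degree.

Exponentials are representations (`expRep_mul`), without the Baker-Campbell-Hausdorff formula. If a
derivation satisfies `D g = g M`, then `D e^{φ(log g)} = e^{φ(log g)} φ(M)`, because the formula for
the derivative of `exp` involves only brackets, which `φ` preserves. Hence `e^{φ(log(gh))}` and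
`e^{φ(log h)}` satisfy the same differential equations in `h`, and their quotient has zero partial
derivatives. By Engel's theorem `V` has a flag of length at most `dim V` on which `φ(ε_{ij})`
descends `j - i` steps, while `(log g)_{ij}` has degree at most `j - i`. So the quotient has degree
below `p`, is therefore constant in `h`, and is evaluated at `h = 1`.

Existence (`exists_frobenius_quotient`, `exists_expProd`). Let `φ` be the differential of `Φ`; it
has nilpotent values because invariant derivations have zero `p`-th power. `Φ` and `Θ = e^{φ(log
g)}` satisfy the same invariant differential equations, so all derivatives of `P = Φ Θ⁻¹` vanish and
`P` is a polynomial in the `x_{ij}^p`. Differentiating the multiplicativity relation shows that `P`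
commutes with `φ`; hence `P` is a representation, and so is its untwist, whose degree is strictly
smaller when `Φ` has positive degree. Induction on the degree finishes.

Morphisms (`comp_eq_of_intertwines_expProd`). The differential of the product is `φ_0`, since the
later factors involve only `p`-th powers. A morphism `f` therefore intertwines `φ_0` and `ψ_0`,
hence the first factors; these are cancelled, the Frobenius twist is undone, and the argument
repeats. For `V = W` and `f = φ_0(X)` the same lemma makes the `φ_i` commute with one another. -/

namespace UnipotentRep

set_option linter.unusedSectionVars false

/-! ### Truncated exponential and logarithm modulo `X ^ p`. -/

section TruncatedSeries

open Polynomial Finset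

/-- The exponential series truncated below degree `p`. -/
noncomputable def expPoly (k : Type*) [Field k] (p : ℕ) : k[X] :=
  ∑ j ∈ range p, C ((j.factorial : k)⁻¹) * X ^ j

/-- The series of `log (1 + X)` truncated below degree `p`. -/
noncomputable def logPoly (k : Type*) [Field k] (p : ℕ) : k[X] :=
  ∑ j ∈ Icc 1 (p - 1), C ((-1 : k) ^ (j - 1) * (j : k)⁻¹) * X ^ j

variable {k : Type*} [Field k] {p : ℕ} [hp : Fact p.Prime] [CharP k p]

theorem natCast_ne_zero_of_lt (k : Type*) [Field k] (p : ℕ) [CharP k p] {j : ℕ} (h0 : j ≠ 0)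
    (h : j < p) : (j : k) ≠ 0 := by
  rw [Ne, CharP.cast_eq_zero_iff k p]
  exact fun hd => absurd (Nat.le_of_dvd (Nat.pos_of_ne_zero h0) hd) (by omega)

theorem factorial_ne_zero_of_lt (k : Type*) [Field k] (p : ℕ) [hp : Fact p.Prime] [CharP k p]
    {j : ℕ} (h : j < p) : (j.factorial : k) ≠ 0 := by
  rw [Ne, CharP.cast_eq_zero_iff k p, hp.out.dvd_factorial]
  omega

theorem coeff_zero_logPoly : (logPoly k p).coeff 0 = 0 := by
  simp only [logPoly, finsetSum_coeff, coeff_C_mul_X_pow]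
  refine Finset.sum_eq_zero fun j hj => if_neg ?_
  have := (mem_Icc.1 hj).1
  omega

/-- The integers `1, …, p - 1` are invertible in `k`, so the derivative is a finite geometric sum in
`-X`. -/
theorem derivative_logPoly :
    (1 + X) * derivative (logPoly k p) = 1 - (-X : k[X]) ^ (p - 1) := by
  have hp1 := hp.out.one_lt
  have h : derivative (logPoly k p) = ∑ j ∈ range (p - 1), (-X : k[X]) ^ j := by
    rw [logPoly, derivative_sum, ← Finset.Ico_succ_right_eq_Icc, Nat.succ_eq_succ,
      Finset.sum_Ico_eq_sum_range]
    refine Finset.sum_congr (by simp) fun j hj => ?_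
    have hj' : j < p - 1 := by simpa using hj
    rw [derivative_C_mul_X_pow, Nat.add_sub_cancel_left, mul_assoc,
      inv_mul_cancel₀ (natCast_ne_zero_of_lt k p (by omega) (by omega)), mul_one, neg_pow (X : k[X])]
    simp
  rw [h, ← mul_neg_geom_sum, sub_neg_eq_add]

theorem derivative_expPoly :
    derivative (expPoly k p) = expPoly k p - C (((p - 1).factorial : k)⁻¹) * X ^ (p - 1) := by
  obtain ⟨q, rfl⟩ : ∃ q, p = q + 1 := ⟨p - 1, by have := hp.out.pos; omega⟩
  rw [expPoly, derivative_sum, Finset.sum_range_succ', Finset.sum_range_succ]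
  simp only [pow_zero, mul_one, derivative_C, add_zero, Nat.add_sub_cancel, add_sub_cancel_right]
  refine Finset.sum_congr rfl fun j hj => ?_
  have hj' : j < q := by simpa using hj
  have := natCast_ne_zero_of_lt k (q + 1) (j := j + 1) (by omega) (by omega)
  rw [derivative_C_mul_X_pow, Nat.add_sub_cancel, Nat.factorial_succ, Nat.cast_mul, mul_inv,
    mul_comm (((j + 1 : ℕ) : k)⁻¹), mul_assoc, inv_mul_cancel₀ this, mul_one]

/-- The composite `F` satisfies `(1 + X) F' = F` modulo `X ^ (p - 1)` and `F(0) = 1`. Comparing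
coefficients gives `(j + 1) F_{j+1} = (1 - j) F_j`, and `j + 1` is invertible for `j + 1 < p`, so
the coefficients are `1, 1, 0, 0, …` below degree `p`. -/
theorem X_pow_dvd_expPoly_comp_logPoly :
    X ^ p ∣ (expPoly k p).comp (logPoly k p) - (1 + X) := by
  have hp1 := hp.out.one_lt
  set F := (expPoly k p).comp (logPoly k p) with hF
  have hX : X ∣ logPoly k p := X_dvd_iff.2 coeff_zero_logPoly
  have h1 : X ^ (p - 1) ∣ (1 + X) * derivative F - F := by
    have : (1 + X) * derivative F - F = -(-X) ^ (p - 1) * (derivative (expPoly k p)).comp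
        (logPoly k p) - C (((p - 1).factorial : k)⁻¹) * logPoly k p ^ (p - 1) := by
      rw [hF, derivative_comp, ← mul_assoc, derivative_logPoly, derivative_expPoly]
      simp only [sub_comp, mul_comp, C_comp, X_pow_comp]
      ring
    rw [this, neg_pow]
    refine dvd_sub ?_ (Dvd.dvd.mul_left (pow_dvd_pow_of_dvd hX _) _)
    exact Dvd.dvd.mul_right (dvd_neg.2 (Dvd.intro_left _ rfl)) _
  have hrec : ∀ j < p - 1, F.coeff (j + 1) * (j + 1) + F.coeff j * j = F.coeff j := by
    intro j hj
    have := (X_pow_dvd_iff.1 h1) j hj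
    rw [coeff_sub, sub_eq_zero, add_mul, one_mul, coeff_add, coeff_derivative] at this
    refine Eq.trans ?_ this
    cases j with
    | zero => simp
    | succ j => rw [coeff_X_mul, coeff_derivative]; push_cast; rfl
  have h0 : F.coeff 0 = 1 := by
    rw [hF, coeff_zero_eq_eval_zero, eval_comp, ← coeff_zero_eq_eval_zero (logPoly k p),
      coeff_zero_logPoly, ← coeff_zero_eq_eval_zero, expPoly, finsetSum_coeff,
      Finset.sum_eq_single 0]
    · simp
    · intro j _ hj
      simp [coeff_X_pow, hj.symm]
    · intro h
      simp [hp.out.ne_zero] at h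
  have h2 : F.coeff 1 = 1 := by
    have := hrec 0 (by omega)
    simpa [h0] using this
  have h3 : ∀ j, j + 2 < p → F.coeff (j + 2) = 0 := by
    intro j
    induction j with
    | zero =>
      intro hj
      have := hrec 1 (by omega)
      have h22 := natCast_ne_zero_of_lt k p (j := 2) (by omega) hj
      rw [h2] at this
      push_cast at this h22
      have h4 : F.coeff 2 * 2 = 0 := by linear_combination this
      simpa [h22] using h4
    | succ j ih =>
      intro hj
      have := hrec (j + 2) (by omega)
      have h22 := natCast_ne_zero_of_lt k p (j := j + 3) (by omega) hj
      rw [ih (by omega)] at this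
      push_cast at this h22
      have h4 : F.coeff (j + 3) * (j + 3) = 0 := by linear_combination this
      simpa [h22] using h4
  rw [X_pow_dvd_iff]
  intro j hj
  rw [coeff_sub, coeff_add, coeff_one, coeff_X]
  match j, hj with
  | 0, _ => simp [h0]
  | 1, _ => simp [h2]
  | j + 2, hj => simp [h3 j hj]

theorem X_dvd_one_sub_expPoly : X ∣ 1 - expPoly k p := by
  rw [X_dvd_iff, coeff_sub, expPoly, finsetSum_coeff, Finset.sum_eq_single 0]
  · simp
  · intro j _ hj
    simp [coeff_X_pow, hj.symm]
  · intro h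
    simp [hp.out.ne_zero] at h

/-- An inverse of the truncated exponential series modulo `X ^ p`. -/
noncomputable def expInvPoly (k : Type*) [Field k] (p : ℕ) : k[X] :=
  ∑ j ∈ range p, (1 - expPoly k p) ^ j

theorem X_pow_dvd_expPoly_mul_expInvPoly : X ^ p ∣ expPoly k p * expInvPoly k p - 1 := by
  have := mul_neg_geom_sum (1 - expPoly k p) p
  rw [sub_sub_cancel] at this
  rw [expInvPoly, this, sub_sub_cancel_left, dvd_neg]
  exact pow_dvd_pow_of_dvd X_dvd_one_sub_expPoly p

variable {S : Type*} [Ring S] [Algebra k S]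

theorem aeval_eq_of_X_pow_dvd_sub {N : S} (hN : N ^ p = 0) {f g : k[X]} (h : X ^ p ∣ f - g) :
    aeval N f = aeval N g := by
  obtain ⟨q, hq⟩ := h
  rw [← sub_eq_zero, ← map_sub, hq, map_mul, map_pow, aeval_X, hN, zero_mul]

theorem aeval_expPoly_aeval_logPoly {N : S} (hN : N ^ p = 0) :
    aeval (aeval N (logPoly k p)) (expPoly k p) = 1 + N := by
  rw [← aeval_comp, aeval_eq_of_X_pow_dvd_sub hN X_pow_dvd_expPoly_comp_logPoly]
  simp

theorem aeval_expPoly_mul_aeval_expInvPoly {N : S} (hN : N ^ p = 0) :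
    aeval N (expPoly k p) * aeval N (expInvPoly k p) = 1 := by
  rw [← map_mul, aeval_eq_of_X_pow_dvd_sub hN X_pow_dvd_expPoly_mul_expInvPoly, map_one]

theorem aeval_expInvPoly_mul_aeval_expPoly {N : S} (hN : N ^ p = 0) :
    aeval N (expInvPoly k p) * aeval N (expPoly k p) = 1 := by
  rw [← map_mul, mul_comm, aeval_eq_of_X_pow_dvd_sub hN X_pow_dvd_expPoly_mul_expInvPoly, map_one]

/-- The nilpotency class is at most `p`, and the terms between it and `p` vanish. This replaces a
cutoff depending on `N` by a fixed polynomial, which is compatible with algebra maps. -/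
theorem nilExp_eq_aeval {N : S} (hN : N ^ p = 0) : nilExp k N = aeval N (expPoly k p) := by
  have h : ∀ j, nilpotencyClass N ≤ j → N ^ j = 0 := fun j hj =>
    pow_eq_zero_of_le hj (pow_nilpotencyClass ⟨p, hN⟩)
  have hle : nilpotencyClass N ≤ p := csInf_le' hN
  simp only [nilExp, expPoly, map_sum, map_mul, aeval_C, map_pow, aeval_X, ← Algebra.smul_def]
  refine Finset.sum_subset (by simpa using hle) fun j _ hj => ?_
  rw [h j (by simpa using hj), smul_zero]

end TruncatedSeries

/-! ### The derivative of the exponential in a noncommutative algebra. -/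

section DerivativeOfExp

open Finset

/-- The operator `ad Z ↦ (1 - e^{-ad Z}) / ad Z`, truncated, applied to `W`. -/
noncomputable def dexp (k : Type*) [Field k] (p : ℕ) {S : Type*} [Ring S] [Algebra k S]
    (Z W : S) : S :=
  ∑ j ∈ range (p - 1), ((-1 : k) ^ j * ((j + 1).factorial : k)⁻¹) •
    ((fun Y => Z * Y - Y * Z)^[j] W)

/-- Both sides are formally `((x + y)^(s+1) - x^(s+1)) / y`. Since `y` need not be cancellable, the
proof is an induction with Pascal's rule. -/
theorem sum_pow_mul_pow_eq_sum_choose {T : Type*} [Ring T] {x y : T} (h : Commute x y) (s : ℕ) :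
    ∑ i ∈ range (s + 1), x ^ i * (x + y) ^ (s - i) =
      ∑ j ∈ range (s + 1), ((s + 1).choose (j + 1) : T) * (x ^ (s - j) * y ^ j) := by
  induction s with
  | zero => simp
  | succ s ih =>
    have h1 : ∑ i ∈ range (s + 2), x ^ i * (x + y) ^ (s + 1 - i) =
        x * ∑ i ∈ range (s + 1), x ^ i * (x + y) ^ (s - i) + (y + x) ^ (s + 1) := by
      rw [Finset.sum_range_succ', Finset.mul_sum]
      simp [pow_succ', mul_assoc, add_comm y x]
    have h2 : ∑ j ∈ range (s + 1), ((s + 1).choose (j + 1) : T) * (x ^ (s + 1 - j) * y ^ j) =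
        x * ∑ j ∈ range (s + 1), ((s + 1).choose (j + 1) : T) * (x ^ (s - j) * y ^ j) := by
      rw [Finset.mul_sum]
      refine Finset.sum_congr rfl fun j hj => ?_
      have : j ≤ s := by simpa [Nat.lt_succ_iff] using hj
      rw [Nat.succ_sub this, pow_succ', (Nat.cast_commute _ x).symm.left_comm]
      simp only [mul_assoc]
    rw [h1, ih, ← h2, (h.symm).add_pow]
    have h3 : ∀ j, ((s + 2).choose (j + 1) : T) * (x ^ (s + 1 - j) * y ^ j) =
        ((s + 1).choose (j + 1) : T) * (x ^ (s + 1 - j) * y ^ j) +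
          y ^ j * x ^ (s + 1 - j) * ((s + 1).choose j : T) := by
      intro j
      rw [Nat.choose_succ_succ, Nat.cast_add, add_mul, add_comm, (h.symm.pow_pow j _).eq,
        (Nat.cast_commute ((s + 1).choose j) _).eq]
    rw [Finset.sum_congr rfl fun j _ => h3 j, Finset.sum_add_distrib,
      Finset.sum_range_succ (fun j => ((s + 1).choose (j + 1) : T) * (x ^ (s + 1 - j) * y ^ j)) (s + 1)]
    simp

variable {k : Type*} [Field k] {p : ℕ} [hp : Fact p.Prime] [CharP k p] {S : Type*} [Ring S]
  [Algebra k S]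

theorem leibniz_pow {D : S →ₗ[k] S} (hD : ∀ a b, D (a * b) = D a * b + a * D b) (Z : S) (m : ℕ) :
    D (Z ^ m) = ∑ i ∈ range m, Z ^ i * D Z * Z ^ (m - 1 - i) := by
  induction m with
  | zero =>
    have := hD 1 1
    simpa using this
  | succ m ih =>
    rw [pow_succ', hD, ih, Finset.sum_range_succ', Finset.mul_sum, add_comm]
    simp [pow_succ', mul_assoc, Nat.sub_sub, add_comm]

/-- The derivative of the exponential: `D(e^Z) = e^Z · ((1 - e^{-ad Z}) / ad Z) (D Z)`. -/
theorem map_aeval_expPoly {D : S →ₗ[k] S} (hD : ∀ a b, D (a * b) = D a * b + a * D b) {Z : S}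
    (hZ : ∀ a b, p - 1 ≤ a + b → Z ^ a * D Z * Z ^ b = 0) :
    D (Polynomial.aeval Z (expPoly k p)) =
      Polynomial.aeval Z (expPoly k p) * dexp k p Z (D Z) := by
  set W := D Z
  have hp1 := hp.out.one_lt
  let c : ℕ → S := fun j => (-1 : k) ^ j • ((fun Y => Z * Y - Y * Z)^[j] W)
  -- Left multiplication `x` and `y = -ad Z` commute and `x + y` is right multiplication. The
  -- binomial lemma therefore rewrites the Leibniz sum `∑ Z^i W Z^(s-i)` with all powers of `Z`
  -- moved to the left.
  let x : Module.End k S := LinearMap.mulLeft k Z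
  let y : Module.End k S := LinearMap.mulRight k Z - LinearMap.mulLeft k Z
  have hxy : Commute x y := by
    refine LinearMap.ext fun a => ?_
    simp [x, y, mul_sub, mul_assoc]
  have hadd : x + y = LinearMap.mulRight k Z := by simp [x, y]
  have hc : ∀ j, (y ^ j) W = c j := by
    intro j
    induction j with
    | zero => simp [c]
    | succ j ih =>
      rw [pow_succ', Module.End.mul_apply, ih]
      simp only [c, y, Function.iterate_succ', Function.comp_apply, map_smul, pow_succ,
        LinearMap.sub_apply, LinearMap.mulLeft_apply, LinearMap.mulRight_apply, mul_smul,
        neg_smul, one_smul, neg_sub]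
  -- `c j` is a combination of words with one `W` and `j` letters `Z`, so `hZ` applies to each word.
  have hvan : ∀ j a b, p - 1 ≤ a + b + j → Z ^ a * c j * Z ^ b = 0 := by
    intro j
    induction j with
    | zero => intro a b h; simpa [c] using hZ a b (by omega)
    | succ j ih =>
      intro a b h
      have : c (j + 1) = c j * Z - Z * c j := by
        rw [← hc, ← hc, pow_succ', Module.End.mul_apply]; simp [y]
      rw [this, mul_sub, sub_mul, mul_assoc, mul_assoc, ← pow_succ', ← mul_assoc,
        ih a (b + 1) (by omega), ← mul_assoc, ← pow_succ, ih (a + 1) b (by omega), sub_zero]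
  have hpow : ∀ s, D (Z ^ (s + 1)) =
      ∑ j ∈ range (s + 1), ((s + 1).choose (j + 1) : k) • (Z ^ (s - j) * c j) := by
    intro s
    have := congrArg (fun T : Module.End k S => T W) (sum_pow_mul_pow_eq_sum_choose hxy s)
    simp only [hadd, LinearMap.sum_apply, Module.End.mul_apply, hc] at this
    rw [leibniz_pow hD]
    simp only [x, LinearMap.pow_mulLeft, LinearMap.pow_mulRight, LinearMap.mulLeft_apply,
      LinearMap.mulRight_apply] at this
    simp only [Nat.add_sub_cancel, mul_assoc]
    rw [this]
    refine Finset.sum_congr rfl fun j _ => ?_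
    rw [Nat.cast_smul_eq_nsmul, Module.End.natCast_apply]
  have hfact : ∀ s < p - 1, ((s + 1).factorial : k)⁻¹ • D (Z ^ (s + 1)) = ∑ j ∈ range (s + 1),
      (((j + 1).factorial : k)⁻¹ * ((s - j).factorial : k)⁻¹) • (Z ^ (s - j) * c j) := by
    intro s hs
    rw [hpow, Finset.smul_sum]
    refine Finset.sum_congr rfl fun j hj => ?_
    have hj' : j ≤ s := by simpa [Nat.lt_succ_iff] using hj
    have h1 := Nat.choose_mul_factorial_mul_factorial (Nat.succ_le_succ hj')
    have h2 := factorial_ne_zero_of_lt k p (j := s + 1) (by omega)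
    have h3 := factorial_ne_zero_of_lt k p (j := j + 1) (by omega)
    have h4 := factorial_ne_zero_of_lt k p (j := s - j) (by omega)
    have h1' : ((s + 1).choose (j + 1) : k) * (j + 1).factorial * (s - j).factorial =
        (s + 1).factorial := by
      rw [← h1]; simp
    rw [smul_smul]
    congr 1
    rw [← mul_inv, inv_mul_eq_iff_eq_mul₀ h2, ← div_eq_mul_inv, eq_div_iff (mul_ne_zero h3 h4),
      ← mul_assoc, h1']
  have hleft : D (Polynomial.aeval Z (expPoly k p)) =
      ∑ s ∈ range (p - 1), ((s + 1).factorial : k)⁻¹ • D (Z ^ (s + 1)) := by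
    obtain ⟨q, hq⟩ : ∃ q, p = q + 1 := ⟨p - 1, by omega⟩
    have h1 : D 1 = 0 := by simpa using hD 1 1
    simp only [expPoly, map_sum, map_mul, Polynomial.aeval_C, map_pow, Polynomial.aeval_X,
      ← Algebra.smul_def, map_smul]
    rw [hq, Finset.sum_range_succ']
    simp [h1]
  have hright : Polynomial.aeval Z (expPoly k p) * dexp k p Z W = ∑ j ∈ range (p - 1),
      ∑ m ∈ range p, (((j + 1).factorial : k)⁻¹ * (m.factorial : k)⁻¹) • (Z ^ m * c j) := by
    simp only [expPoly, map_sum, map_mul, Polynomial.aeval_C, map_pow, Polynomial.aeval_X,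
      ← Algebra.smul_def, dexp]
    rw [Finset.sum_mul_sum, Finset.sum_comm]
    refine Finset.sum_congr rfl fun j _ => Finset.sum_congr rfl fun m _ => ?_
    simp only [c, smul_mul_assoc, mul_smul_comm, smul_smul]
    congr 1
    ring
  rw [hleft, hright, Finset.sum_congr rfl fun s hs => hfact s (mem_range.1 hs),
    Finset.sum_range_diag_flip (p - 1) fun j m =>
      (((j + 1).factorial : k)⁻¹ * (m.factorial : k)⁻¹) • (Z ^ m * c j)]
  -- The left side runs over the triangle `j + m < p - 1`, the right side over a full rectangle; the
  -- extra terms vanish by `hvan`.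
  refine Finset.sum_congr rfl fun j hj => Finset.sum_subset ?_ fun m _ hm => ?_
  · intro m hm
    simp only [mem_range] at hm ⊢
    omega
  · simp only [mem_range] at hm hj
    have := hvan j m 0 (by omega)
    rw [pow_zero, mul_one] at this
    rw [this, smul_zero]

/-- `dexp` is built from iterated brackets with `Z`, so preservation of these brackets suffices. It
is applied to the scalar extension of a Lie homomorphism, which is not multiplicative. -/
theorem map_dexp {S' : Type*} [Ring S'] [Algebra k S'] {f : S →ₗ[k] S'} {L : Set S} {Z W : S}
    (hL : ∀ Y ∈ L, Z * Y - Y * Z ∈ L ∧ f (Z * Y - Y * Z) = f Z * f Y - f Y * f Z) (hW : W ∈ L) :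
    f (dexp k p Z W) = dexp k p (f Z) (f W) := by
  have h : ∀ j, (fun Y => Z * Y - Y * Z)^[j] W ∈ L ∧ f ((fun Y => Z * Y - Y * Z)^[j] W) =
      (fun Y => f Z * Y - Y * f Z)^[j] (f W) := by
    intro j
    induction j with
    | zero => exact ⟨hW, rfl⟩
    | succ j ih =>
      simp only [Function.iterate_succ', Function.comp_apply]
      exact ⟨(hL _ ih.1).1, by rw [(hL _ ih.1).2, ih.2]⟩
  simp only [dexp, map_sum, map_smul, (h _).2]

end DerivativeOfExp

/-! ### Derivations, change of coefficients and contractions on `B ⊗ R`. -/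

section TensorTools

variable {k : Type*} [Field k] {B : Type*} [Ring B] [Algebra k B] {R R' : Type*} [CommRing R]
  [Algebra k R] [CommRing R'] [Algebra k R']

theorem lTensor_derivation_mul (D : Derivation k R R) (x y : B ⊗[k] R) :
    (D : R →ₗ[k] R).lTensor B (x * y) =
      (D : R →ₗ[k] R).lTensor B x * y + x * (D : R →ₗ[k] R).lTensor B y := by
  induction x with
  | zero => simp
  | add x x' hx hx' => simp only [add_mul, map_add, hx, hx']; abel
  | tmul b r =>
    induction y with
    | zero => simp
    | add y y' hy hy' => simp only [mul_add, map_add, hy, hy']; abel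
    | tmul c s =>
      simp only [Algebra.TensorProduct.tmul_mul_tmul, LinearMap.lTensor_tmul,
        Derivation.coeFn_coe, Derivation.leibniz, smul_eq_mul, TensorProduct.tmul_add]
      rw [add_comm, mul_comm s]

/-- Change of coefficient ring in `B ⊗ R`. -/
noncomputable def coeffMap (B : Type*) [Ring B] [Algebra k B] (h : R →ₐ[k] R') :
    B ⊗[k] R →ₐ[k] B ⊗[k] R' :=
  Algebra.TensorProduct.map (AlgHom.id k B) h

@[simp]
theorem coeffMap_tmul (h : R →ₐ[k] R') (b : B) (r : R) :
    coeffMap B h (b ⊗ₜ[k] r) = b ⊗ₜ[k] h r := rfl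

theorem coeffMap_apply (h : R →ₐ[k] R') (x : B ⊗[k] R) :
    coeffMap B h x = h.toLinearMap.lTensor B x := rfl

theorem lTensor_lTensor {M N P : Type*} [AddCommGroup M] [Module k M] [AddCommGroup N]
    [Module k N] [AddCommGroup P] [Module k P] (g : N →ₗ[k] P) (f : M →ₗ[k] N) (x : B ⊗[k] M) :
    g.lTensor B (f.lTensor B x) = (g ∘ₗ f).lTensor B x := by
  rw [LinearMap.lTensor_comp_apply]

theorem lTensor_congr {M N : Type*} [AddCommGroup M] [Module k M] [AddCommGroup N]
    [Module k N] {f g : M →ₗ[k] N} (h : ∀ x, f x = g x) (x : B ⊗[k] M) :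
    f.lTensor B x = g.lTensor B x := by
  rw [LinearMap.ext h]

theorem coeffMap_coeffMap {R'' : Type*} [CommRing R''] [Algebra k R''] (u : R' →ₐ[k] R'')
    (v : R →ₐ[k] R') (x : B ⊗[k] R) :
    coeffMap B u (coeffMap B v x) = coeffMap B (u.comp v) x := by
  rw [coeffMap_apply, coeffMap_apply, lTensor_lTensor]
  rfl

theorem coeffMap_congr {u v : R →ₐ[k] R'} (h : ∀ a, u a = v a) (x : B ⊗[k] R) :
    coeffMap B u x = coeffMap B v x := by
  rw [AlgHom.ext h]

theorem lTensor_injective {M N : Type*} [AddCommGroup M] [Module k M] [AddCommGroup N]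
    [Module k N] {f : M →ₗ[k] N} (h : Function.Injective f) :
    Function.Injective (f.lTensor B) :=
  Module.Flat.lTensor_preserves_injective_linearMap f h

/-- The contraction of `B ⊗ M` with a linear form on `B`. -/
noncomputable def slice {M : Type*} [AddCommGroup M] [Module k M] (l : Module.Dual k B) :
    B ⊗[k] M →ₗ[k] M :=
  (TensorProduct.lid k M).toLinearMap ∘ₗ l.rTensor M

@[simp]
theorem slice_tmul {M : Type*} [AddCommGroup M] [Module k M] (l : Module.Dual k B) (b : B)
    (m : M) : slice l (b ⊗ₜ[k] m) = l b • m := by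
  simp [slice]

theorem slice_lTensor {M N : Type*} [AddCommGroup M] [Module k M] [AddCommGroup N] [Module k N]
    (l : Module.Dual k B) (f : M →ₗ[k] N) (x : B ⊗[k] M) :
    slice l (f.lTensor B x) = f (slice l x) := by
  induction x with
  | zero => simp
  | add x y hx hy => simp [hx, hy]
  | tmul b m => simp

/-- The coordinate forms of a basis of `B` already separate points. This carries statements about
polynomials over to polynomials with coefficients in `B`. -/
theorem eq_of_slice_eq {M : Type*} [AddCommGroup M] [Module k M] {x y : B ⊗[k] M}
    (h : ∀ l : Module.Dual k B, slice l x = slice l y) : x = y := by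
  classical
  let b := Module.Basis.ofVectorSpace k B
  refine (TensorProduct.equivFinsuppOfBasisLeft b (N := M)).injective (Finsupp.ext fun i => ?_)
  have key : ∀ z : B ⊗[k] M, TensorProduct.equivFinsuppOfBasisLeft b z i = slice (b.coord i) z := by
    intro z
    induction z with
    | zero => simp
    | add x y hx hy => simp [hx, hy]
    | tmul c m => simp
  rw [key, key, h]

end TensorTools

/-! ### Polynomials with vanishing partial derivatives in characteristic `p`. -/

section PolynomialTools

open MvPolynomial

variable {k : Type*} [Field k] {p : ℕ} [hp : Fact p.Prime] [CharP k p] {σ : Type*}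

/-- The partial derivative in direction `r` multiplies the coefficient at `m` by `m r`, a scalar of
`k`, which is invertible unless `p ∣ m r`. This works over any `k`-algebra `K`. -/
theorem dvd_of_pderiv_eq_zero {K : Type*} [CommRing K] [Algebra k K] {f : MvPolynomial σ K}
    (hf : ∀ r, pderiv r f = 0) {m : σ →₀ ℕ} (hm : m ∈ f.support) (r : σ) : p ∣ m r := by
  by_contra hd
  have h0 : m r ≠ 0 := fun h => hd (h ▸ dvd_zero p)
  have h1 := coeff_pderiv (i := r) f (m - Finsupp.single r 1)
  have h2 : m - Finsupp.single r 1 + Finsupp.single r 1 = m :=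
    tsub_add_cancel_of_le (Finsupp.single_le_iff.2 (Nat.one_le_iff_ne_zero.2 h0))
  have h3 : (((m - Finsupp.single r 1 : σ →₀ ℕ) r : ℕ) : K) + 1 = ((m r : ℕ) : K) := by
    rw [Finsupp.tsub_apply, Finsupp.single_eq_same, ← Nat.cast_succ, Nat.succ_eq_add_one,
      Nat.sub_add_cancel (Nat.one_le_iff_ne_zero.2 h0)]
  rw [h2, h3, hf, coeff_zero, ← map_natCast (algebraMap k K), mul_comm, ← Algebra.smul_def] at h1
  have h4 : (m r : k) ≠ 0 := by rwa [Ne, CharP.cast_eq_zero_iff k p]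
  exact mem_support_iff.1 hm ((smul_eq_zero_iff_right h4).1 h1.symm)

theorem eq_C_of_pderiv_eq_zero {K : Type*} [CommRing K] [Algebra k K] {f : MvPolynomial σ K}
    (hf : ∀ r, pderiv r f = 0) (hdeg : f.totalDegree < p) : f = C (coeff 0 f) := by
  refine totalDegree_eq_zero_iff_eq_C.1 ((totalDegree_eq_zero_iff _ _).2 fun m hm r => ?_)
  have h1 := dvd_of_pderiv_eq_zero (k := k) (p := p) hf hm r
  by_contra h0
  have h2 := Nat.le_of_dvd (Nat.pos_of_ne_zero h0) h1
  have h3 : m r ≤ f.totalDegree := (Finsupp.le_degree r m).trans (le_totalDegree hm)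
  omega

/-- The linear map with `x^{p m} ↦ x^m`, which kills the other monomials. -/
noncomputable def contract (k : Type*) [Field k] (p : ℕ) (σ : Type*) :
    MvPolynomial σ k →ₗ[k] MvPolynomial σ k :=
  (basisMonomials σ k).constr k fun m => open Classical in
    if ∀ r, p ∣ m r then monomial (m.mapRange (· / p) (Nat.zero_div p)) 1 else 0

theorem contract_monomial (m : σ →₀ ℕ) (c : k) : contract k p σ (monomial m c) =
    open Classical in
    if ∀ r, p ∣ m r then monomial (m.mapRange (· / p) (Nat.zero_div p)) c else 0 := by
  classical
  have h : monomial m c = c • (monomial m 1 : MvPolynomial σ k) := by simp [smul_monomial]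
  have h1 := (basisMonomials σ k).constr_basis k (fun m => open Classical in
    if ∀ r, p ∣ m r then (monomial (m.mapRange (· / p) (Nat.zero_div p)) 1 : MvPolynomial σ k)
    else 0) m
  rw [coe_basisMonomials] at h1
  rw [h, map_smul, contract, h1]
  split_ifs <;> simp [smul_monomial]

theorem expand_contract {f : MvPolynomial σ k} (hf : ∀ m ∈ f.support, ∀ r, p ∣ m r) :
    expand p (contract k p σ f) = f := by
  conv_lhs => rw [f.as_sum]
  conv_rhs => rw [f.as_sum]
  rw [map_sum, map_sum]
  refine Finset.sum_congr rfl fun m hm => ?_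
  have h : p • m.mapRange (· / p) (Nat.zero_div p) = m := by
    ext r
    simp [Nat.mul_div_cancel' (hf m hm r)]
  rw [contract_monomial, if_pos (hf m hm), expand_monomial, h]

theorem totalDegree_contract_le (f : MvPolynomial σ k) :
    (contract k p σ f).totalDegree ≤ f.totalDegree / p := by
  classical
  conv_lhs => rw [f.as_sum]
  rw [map_sum]
  refine totalDegree_finsetSum_le fun m hm => ?_
  rw [contract_monomial]
  split_ifs with h
  · refine (totalDegree_monomial_le _ _).trans ?_
    rw [Nat.le_div_iff_mul_le hp.out.pos]
    refine le_trans ?_ (le_totalDegree hm)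
    rw [Finsupp.sum_mapRange_index (by simp), Finsupp.sum, Finsupp.sum, Finset.sum_mul]
    exact Finset.sum_le_sum fun r _ => Nat.div_mul_le_self _ _
  · simp

end PolynomialTools

/-! ### Matrices supported on high superdiagonals. -/

section Band

variable {n : ℕ} {R : Type*} [CommRing R]

/-- Matrices that vanish below the `m`-th superdiagonal. -/
def band (n : ℕ) (R : Type*) [CommRing R] (m : ℕ) : Submodule R (Matrix (Fin n) (Fin n) R) where
  carrier := {M | ∀ i j : Fin n, (j : ℕ) < i + m → M i j = 0}
  zero_mem' := fun _ _ _ => rfl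
  add_mem' := fun {M N} hM hN i j h => by simp [hM i j h, hN i j h]
  smul_mem' := fun c M hM i j h => by simp [hM i j h]

theorem band_antitone : Antitone (band n R) := fun _ _ h _ hM i j hij => hM i j (by omega)

theorem mul_mem_band {a b : ℕ} {M N : Matrix (Fin n) (Fin n) R} (hM : M ∈ band n R a)
    (hN : N ∈ band n R b) : M * N ∈ band n R (a + b) := by
  intro i j hij
  rw [Matrix.mul_apply]
  refine Finset.sum_eq_zero fun l _ => ?_
  by_cases hl : (l : ℕ) < i + a
  · rw [hM i l hl, zero_mul]
  · rw [hN l j (by omega), mul_zero]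

theorem one_mem_band : (1 : Matrix (Fin n) (Fin n) R) ∈ band n R 0 := fun i j hij =>
  Matrix.one_apply_ne (by rintro rfl; omega)

theorem pow_mem_band {M : Matrix (Fin n) (Fin n) R} (hM : M ∈ band n R 1) (a : ℕ) :
    M ^ a ∈ band n R a := by
  induction a with
  | zero => simpa using one_mem_band
  | succ a ih => rw [pow_succ]; exact mul_mem_band ih hM

theorem eq_zero_of_mem_band {m : ℕ} (hm : n ≤ m) {M : Matrix (Fin n) (Fin n) R}
    (hM : M ∈ band n R m) : M = 0 := by
  ext i j
  exact hM i j (by omega)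

theorem map_mem_band {R' : Type*} [CommRing R'] {m : ℕ} {M : Matrix (Fin n) (Fin n) R}
    (hM : M ∈ band n R m) {f : R → R'} (hf : f 0 = 0) : M.map f ∈ band n R' m := fun i j hij => by
  rw [Matrix.map_apply, hM i j hij, hf]

theorem mul_sub_one_mem_band {g h : Matrix (Fin n) (Fin n) R} (hg : g - 1 ∈ band n R 1)
    (hh : h - 1 ∈ band n R 1) : g * h - 1 ∈ band n R 1 := by
  have : g * h - 1 = (g - 1) * (h - 1) + (g - 1) + (h - 1) := by noncomm_ring
  rw [this]
  exact add_mem (add_mem (band_antitone (by omega) (mul_mem_band hg hh)) hg) hh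

theorem exists_inverse {g : Matrix (Fin n) (Fin n) R} (hg : g - 1 ∈ band n R 1) :
    ∃ g' ∈ band n R 0, g * g' = 1 ∧ g' * g = 1 := by
  have hN : 1 - g ∈ band n R 1 := by rw [← neg_sub]; exact neg_mem hg
  refine ⟨∑ j ∈ Finset.range n, (1 - g) ^ j, sum_mem fun j _ =>
    band_antitone (Nat.zero_le _) (pow_mem_band hN j), ?_, ?_⟩
  · have := mul_neg_geom_sum (1 - g) n
    rwa [sub_sub_cancel, eq_zero_of_mem_band le_rfl (pow_mem_band hN n), sub_zero] at this
  · have := geom_sum_mul_neg (1 - g) n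
    rwa [sub_sub_cancel, eq_zero_of_mem_band le_rfl (pow_mem_band hN n), sub_zero] at this

theorem eq_sum_single {M : Matrix (Fin n) (Fin n) R} (hM : M ∈ band n R 1) :
    M = ∑ r : Pos n, Matrix.single r.1.1 r.1.2 (M r.1.1 r.1.2) := by
  ext i j
  rw [Matrix.sum_apply]
  by_cases hij : i < j
  · rw [Finset.sum_eq_single ⟨(i, j), hij⟩]
    · simp
    · rintro ⟨⟨a, b⟩, hab⟩ _ hne
      rw [Matrix.single_apply, if_neg]
      rintro ⟨rfl, rfl⟩
      exact hne rfl
    · simp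
  · rw [hM i j (by omega)]
    refine (Finset.sum_eq_zero fun r _ => ?_).symm
    rw [Matrix.single_apply, if_neg]
    rintro ⟨rfl, rfl⟩
    exact hij r.2

theorem single_mem_band (r : Pos n) (a : R) : Matrix.single r.1.1 r.1.2 a ∈ band n R 1 := by
  intro i j hij
  rw [Matrix.single_apply, if_neg]
  rintro ⟨rfl, rfl⟩
  have := r.2
  omega

end Band

/-! ### Extension of scalars of a Lie homomorphism. -/

section Extend

variable {k : Type*} [Field k] {n : ℕ} {B : Type*} [Ring B] [Algebra k B]

/-- The extension of scalars of `φ` to strictly upper triangular matrices over `R`. -/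
noncomputable def extend (φ : strictUpper k n →ₗ⁅k⁆ B) (R : Type*) [CommRing R] [Algebra k R] :
    Matrix (Fin n) (Fin n) R →ₗ[k] B ⊗[k] R :=
  ∑ r : Pos n, (TensorProduct.mk k B R (φ (matrixUnit k r))) ∘ₗ
    (Matrix.entryLinearMap k R r.1.1 r.1.2)

variable {R : Type*} [CommRing R] [Algebra k R]

theorem extend_apply (φ : strictUpper k n →ₗ⁅k⁆ B) (M : Matrix (Fin n) (Fin n) R) :
    extend φ R M = ∑ r : Pos n, φ (matrixUnit k r) ⊗ₜ[k] M r.1.1 r.1.2 := by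
  simp [extend]

theorem lTensor_extend {R' : Type*} [CommRing R'] [Algebra k R'] (φ : strictUpper k n →ₗ⁅k⁆ B)
    (u : R →ₗ[k] R') (M : Matrix (Fin n) (Fin n) R) :
    u.lTensor B (extend φ R M) = extend φ R' (M.map u) := by
  simp [extend_apply]

theorem eq_sum_matrixUnit (X : strictUpper k n) :
    X = ∑ r : Pos n, (X : Matrix (Fin n) (Fin n) k) r.1.1 r.1.2 • matrixUnit k r := by
  apply Subtype.ext
  have h : (X : Matrix (Fin n) (Fin n) k) ∈ band n k 1 := fun i j hij => X.2 i j (by omega)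
  conv_lhs => rw [eq_sum_single h]
  rw [AddSubmonoidClass.coe_finsetSum]
  refine Finset.sum_congr rfl fun r _ => ?_
  simp [matrixUnit, Matrix.smul_single]

theorem extend_map_smul (φ : strictUpper k n →ₗ⁅k⁆ B) (X : strictUpper k n) (a : R) :
    extend φ R ((X : Matrix (Fin n) (Fin n) k).map fun c => c • a) = φ X ⊗ₜ[k] a := by
  conv_rhs => rw [eq_sum_matrixUnit X]
  simp [extend_apply, map_sum, TensorProduct.sum_tmul, TensorProduct.smul_tmul]

/-- By bilinearity it is enough to treat matrices with a single nonzero entry. There the bracket of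
`X ⊗ a` and `Y ⊗ b` is `[X, Y] ⊗ ab`, as `R` is commutative. -/
theorem extend_lie (φ : strictUpper k n →ₗ⁅k⁆ B) {M N : Matrix (Fin n) (Fin n) R}
    (hM : M ∈ band n R 1) (hN : N ∈ band n R 1) :
    extend φ R (M * N - N * M) =
      extend φ R M * extend φ R N - extend φ R N * extend φ R M := by
  have hs : ∀ (r : Pos n) (a : R), Matrix.single r.1.1 r.1.2 a =
      (matrixUnit k r : Matrix (Fin n) (Fin n) k).map fun c => c • a := by
    intro r a
    ext i j
    simp only [matrixUnit, Matrix.map_apply, Matrix.single_apply]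
    split_ifs <;> simp
  have hmul : ∀ (X Y : Matrix (Fin n) (Fin n) k) (a b : R),
      (X.map fun c => c • a) * (Y.map fun c => c • b) = (X * Y).map fun c => c • (a * b) := by
    intro X Y a b
    ext i j
    simp [Matrix.mul_apply, Finset.sum_smul, smul_smul, mul_comm]
  have h1 : ∀ (r s : Pos n) (a b : R),
      extend φ R (Matrix.single r.1.1 r.1.2 a * Matrix.single s.1.1 s.1.2 b -
        Matrix.single s.1.1 s.1.2 b * Matrix.single r.1.1 r.1.2 a) =
      extend φ R (Matrix.single r.1.1 r.1.2 a) * extend φ R (Matrix.single s.1.1 s.1.2 b) -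
      extend φ R (Matrix.single s.1.1 s.1.2 b) * extend φ R (Matrix.single r.1.1 r.1.2 a) := by
    intro r s a b
    rw [hs, hs, hmul, hmul, mul_comm b a]
    have h2 : ((matrixUnit k r : Matrix (Fin n) (Fin n) k) * matrixUnit k s).map
        (fun c => c • (a * b)) - ((matrixUnit k s : Matrix (Fin n) (Fin n) k) *
          matrixUnit k r).map (fun c => c • (a * b)) =
        ((⁅matrixUnit k r, matrixUnit k s⁆ : strictUpper k n) : Matrix (Fin n) (Fin n) k).map
          fun c => c • (a * b) := by
      rw [LieSubalgebra.coe_bracket, Ring.lie_def]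
      ext i j
      simp [sub_smul]
    rw [h2]
    simp only [extend_map_smul, LieHom.map_lie, Ring.lie_def, TensorProduct.sub_tmul,
      Algebra.TensorProduct.tmul_mul_tmul, mul_comm b a]
  have h3 : ∀ a b : Pos n → Matrix (Fin n) (Fin n) R,
      (∀ r s, extend φ R (a r * b s - b s * a r) =
        extend φ R (a r) * extend φ R (b s) - extend φ R (b s) * extend φ R (a r)) →
      extend φ R ((∑ r, a r) * (∑ s, b s) - (∑ s, b s) * ∑ r, a r) =
        extend φ R (∑ r, a r) * extend φ R (∑ s, b s) -
          extend φ R (∑ s, b s) * extend φ R (∑ r, a r) := by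
    intro a b h
    rw [Finset.sum_mul_sum, Finset.sum_mul_sum, Finset.sum_comm (f := fun s r => b s * a r),
      map_sum, map_sum, Finset.sum_mul_sum, Finset.sum_mul_sum,
      Finset.sum_comm (f := fun s r => extend φ R (b s) * extend φ R (a r))]
    simp only [map_sum, ← Finset.sum_sub_distrib, h]
  rw [eq_sum_single hM, eq_sum_single hN]
  exact h3 _ _ fun r s => h1 r s _ _

end Extend

/-! ### Nilpotent filtrations and degree bounds. -/

section Filtration

variable {k : Type*} [Field k] {B : Type*} [Ring B] [Algebra k B]

/-- A decreasing multiplicative filtration of `B` that vanishes from `d` on. -/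
structure IsNilFiltration (E : ℕ → Submodule k B) (d : ℕ) : Prop where
  one_mem : 1 ∈ E 0
  mul_mem : ∀ {i j a b}, a ∈ E i → b ∈ E j → a * b ∈ E (i + j)
  antitone : Antitone E
  eq_bot : ∀ i, d ≤ i → E i = ⊥

/-- The filtration of `B ⊗ R` induced by one of `B`. -/
def tensorFil (E : ℕ → Submodule k B) (R : Type*) [CommRing R] [Algebra k R] (i : ℕ) :
    Submodule k (B ⊗[k] R) :=
  Submodule.span k {x | ∃ b ∈ E i, ∃ r : R, x = b ⊗ₜ[k] r}

/-- The elements of `B ⊗ K[σ]` of degree at most `D`. -/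
noncomputable def degLE (k B : Type*) [Field k] [Ring B] [Algebra k B] (σ K : Type*) [CommRing K] [Algebra k K]
    (D : ℕ) : Submodule k (B ⊗[k] MvPolynomial σ K) :=
  Submodule.span k {x | ∃ (b : B) (f : MvPolynomial σ K), f.totalDegree ≤ D ∧ x = b ⊗ₜ[k] f}

/-- The span of the `b ⊗ f` where `b` lies at least as deep in the filtration as the degree
of `f`. -/
noncomputable def degFil (E : ℕ → Submodule k B) (σ K : Type*) [CommRing K] [Algebra k K] :
    Submodule k (B ⊗[k] MvPolynomial σ K) :=
  Submodule.span k {x | ∃ (i : ℕ), ∃ b ∈ E i, ∃ f : MvPolynomial σ K, f.totalDegree ≤ i ∧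
    x = b ⊗ₜ[k] f}

variable {E : ℕ → Submodule k B} {d : ℕ}

theorem mul_mem_of_span {S : Type*} [Ring S] [Algebra k S] {s t : Set S} {N : Submodule k S}
    (h : ∀ x ∈ s, ∀ y ∈ t, x * y ∈ N) {x y : S} (hx : x ∈ Submodule.span k s)
    (hy : y ∈ Submodule.span k t) : x * y ∈ N := by
  have h1 : Submodule.span k s * Submodule.span k t ≤ N := by
    rw [Submodule.span_mul_span, Submodule.span_le]
    rintro _ ⟨x, hx, y, hy, rfl⟩
    exact h x hx y hy
  exact h1 (Submodule.mul_mem_mul hx hy)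

section

variable {R : Type*} [CommRing R] [Algebra k R]

theorem tensorFil_mul_mem (hE : IsNilFiltration E d) {i j : ℕ} {x y : B ⊗[k] R}
    (hx : x ∈ tensorFil E R i) (hy : y ∈ tensorFil E R j) : x * y ∈ tensorFil E R (i + j) := by
  refine mul_mem_of_span ?_ hx hy
  rintro _ ⟨b, hb, r, rfl⟩ _ ⟨c, hc, s, rfl⟩
  exact Submodule.subset_span ⟨b * c, hE.mul_mem hb hc, r * s,
    Algebra.TensorProduct.tmul_mul_tmul ..⟩

theorem tensorFil_pow_mem (hE : IsNilFiltration E d) {x : B ⊗[k] R} (hx : x ∈ tensorFil E R 1)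
    (m : ℕ) : x ^ m ∈ tensorFil E R m := by
  induction m with
  | zero =>
    rw [pow_zero]
    exact Submodule.subset_span ⟨1, hE.one_mem, 1, rfl⟩
  | succ m ih => rw [pow_succ]; exact tensorFil_mul_mem hE ih hx

theorem eq_zero_of_mem_tensorFil (hE : IsNilFiltration E d) {i : ℕ} (hi : d ≤ i) {x : B ⊗[k] R}
    (hx : x ∈ tensorFil E R i) : x = 0 := by
  have h : tensorFil E R i ≤ ⊥ := by
    rw [tensorFil, Submodule.span_le]
    rintro _ ⟨b, hb, r, rfl⟩
    rw [hE.eq_bot i hi, Submodule.mem_bot] at hb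
    simp [hb]
  simpa using h hx

end

variable {σ K : Type*} [CommRing K] [Algebra k K]

/-- `degFil` as a subalgebra. -/
noncomputable def degFilSubalgebra (hE : IsNilFiltration E d) (σ K : Type*) [CommRing K] [Algebra k K] :
    Subalgebra k (B ⊗[k] MvPolynomial σ K) :=
  (degFil E σ K).toSubalgebra (Submodule.subset_span ⟨0, 1, hE.one_mem, 1, by simp, rfl⟩)
    fun x y hx hy => by
      refine mul_mem_of_span ?_ hx hy
      rintro _ ⟨i, b, hb, f, hf, rfl⟩ _ ⟨j, c, hc, g, hg, rfl⟩
      exact Submodule.subset_span ⟨i + j, b * c, hE.mul_mem hb hc, f * g,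
        (MvPolynomial.totalDegree_mul f g).trans (add_le_add hf hg),
      Algebra.TensorProduct.tmul_mul_tmul ..⟩

/-- A generator whose index `i` is at least `d` has its coefficient in `E i = 0`, so only degrees
below `d` survive. This is the source of every degree bound below `p`. -/
theorem degFil_le_degLE (hE : IsNilFiltration E d) : degFil E σ K ≤ degLE k B σ K (d - 1) := by
  rw [degFil, Submodule.span_le]
  rintro _ ⟨i, b, hb, f, hf, rfl⟩
  by_cases hi : d ≤ i
  · rw [hE.eq_bot i hi, Submodule.mem_bot] at hb
    simp [hb]
  · exact Submodule.subset_span ⟨b, f, by omega, rfl⟩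

theorem degLE_mono {D D' : ℕ} (h : D ≤ D') : degLE k B σ K D ≤ degLE k B σ K D' :=
  Submodule.span_mono fun _ ⟨b, f, hf, hx⟩ => ⟨b, f, hf.trans h, hx⟩

theorem degLE_mul_mem {D D' : ℕ} {x y : B ⊗[k] MvPolynomial σ K} (hx : x ∈ degLE k B σ K D)
    (hy : y ∈ degLE k B σ K D') : x * y ∈ degLE k B σ K (D + D') := by
  refine mul_mem_of_span ?_ hx hy
  rintro _ ⟨b, f, hf, rfl⟩ _ ⟨c, g, hg, rfl⟩
  exact Submodule.subset_span ⟨b * c, f * g,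
    (MvPolynomial.totalDegree_mul f g).trans (add_le_add hf hg),
      Algebra.TensorProduct.tmul_mul_tmul ..⟩

theorem exists_mem_degLE (x : B ⊗[k] MvPolynomial σ K) : ∃ D, x ∈ degLE k B σ K D := by
  induction x with
  | zero => exact ⟨0, zero_mem _⟩
  | add x y hx hy =>
    obtain ⟨D, hD⟩ := hx
    obtain ⟨D', hD'⟩ := hy
    exact ⟨max D D', add_mem (degLE_mono (le_max_left _ _) hD) (degLE_mono (le_max_right _ _) hD')⟩
  | tmul b f => exact ⟨f.totalDegree, Submodule.subset_span ⟨b, f, le_rfl, rfl⟩⟩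

theorem totalDegree_slice_le {D : ℕ} {x : B ⊗[k] MvPolynomial σ K} (hx : x ∈ degLE k B σ K D)
    (l : Module.Dual k B) : (slice l x).totalDegree ≤ D := by
  induction hx using Submodule.span_induction with
  | mem x hx =>
    obtain ⟨b, f, hf, rfl⟩ := hx
    rw [slice_tmul]
    exact (MvPolynomial.totalDegree_smul_le _ _).trans hf
  | zero => simp
  | add x y _ _ hx hy =>
    rw [map_add]
    exact (MvPolynomial.totalDegree_add _ _).trans (max_le hx hy)
  | smul c x _ hx =>
    rw [map_smul]
    exact (MvPolynomial.totalDegree_smul_le _ _).trans hx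

variable {p : ℕ} [hp : Fact p.Prime] [CharP k p]

/-- Evaluation at the origin. -/
noncomputable def evalZero (k : Type*) [Field k] (σ K : Type*) [CommRing K] [Algebra k K] :
    MvPolynomial σ K →ₐ[k] K :=
  (MvPolynomial.aeval (R := K) fun _ : σ => (0 : K)).restrictScalars k

/-- Inclusion of the constants. -/
noncomputable def constants (k : Type*) [Field k] (σ K : Type*) [CommRing K] [Algebra k K] :
    K →ₐ[k] MvPolynomial σ K :=
  (Algebra.ofId K (MvPolynomial σ K)).restrictScalars k

/-- Each contraction of `x` is a polynomial of degree below `p` whose exponents are all divisible by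
`p`, hence a constant. -/
theorem eq_constant_of_pderiv_eq_zero {D : ℕ} (hD : D < p) {x : B ⊗[k] MvPolynomial σ K}
    (hx : x ∈ degLE k B σ K D) (h : ∀ r, (((MvPolynomial.pderiv r).restrictScalars k :
      Derivation k (MvPolynomial σ K) (MvPolynomial σ K)) :
        MvPolynomial σ K →ₗ[k] MvPolynomial σ K).lTensor B x = 0) :
    x = coeffMap B (constants k σ K) (coeffMap B (evalZero k σ K) x) := by
  refine eq_of_slice_eq fun l => ?_
  rw [coeffMap_apply, coeffMap_apply, slice_lTensor, slice_lTensor]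
  have h1 := eq_C_of_pderiv_eq_zero (k := k) (p := p) (f := slice l x) (fun r => by
    have := congrArg (slice l) (h r)
    rw [slice_lTensor, map_zero] at this
    exact this) ((totalDegree_slice_le hx l).trans_lt hD)
  conv_lhs => rw [h1]
  rw [← MvPolynomial.constantCoeff_eq]
  simp [constants, evalZero, Algebra.ofId_apply, MvPolynomial.algebraMap_eq,
    MvPolynomial.aeval_zero']

end Filtration

/-! ### The function `e^{φ(log g)}` and its differential equation. -/

section ExpRep

open Polynomial

variable {k : Type*} [Field k] {n : ℕ} {B : Type*} [Ring B] [Algebra k B]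
  {R : Type*} [CommRing R] [Algebra k R]

theorem aeval_mem_subalgebra {S : Type*} [Ring S] [Algebra k S] {T : Subalgebra k S} {x : S}
    (hx : x ∈ T) (q : k[X]) : aeval x q ∈ T :=
  Algebra.adjoin_le (Set.singleton_subset_iff.2 hx) (aeval_mem_adjoin_singleton k x)

/-- The logarithm of a unipotent matrix. -/
noncomputable def logMatrix (k : Type*) [Field k] (p : ℕ) {n : ℕ} {R : Type*} [CommRing R]
    [Algebra k R] (g : Matrix (Fin n) (Fin n) R) : Matrix (Fin n) (Fin n) R :=
  aeval (g - 1) (logPoly k p)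

/-- `e^{φ(log g)}` for a unipotent matrix `g` over `R`. -/
noncomputable def expRep (p : ℕ) (φ : strictUpper k n →ₗ⁅k⁆ B) (g : Matrix (Fin n) (Fin n) R) :
    B ⊗[k] R :=
  aeval (extend φ R (logMatrix k p g)) (expPoly k p)

/-- `e^{-φ(log g)}` for a unipotent matrix `g` over `R`. -/
noncomputable def expRepInv (p : ℕ) (φ : strictUpper k n →ₗ⁅k⁆ B)
    (g : Matrix (Fin n) (Fin n) R) : B ⊗[k] R :=
  aeval (extend φ R (logMatrix k p g)) (expInvPoly k p)

/-- `φ` maps `ε_{ij}` to the `(j - i)`-th step of the filtration. -/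
def IsAdapted (E : ℕ → Submodule k B) (φ : strictUpper k n →ₗ⁅k⁆ B) : Prop :=
  ∀ r : Pos n, φ (matrixUnit k r) ∈ E (r.1.2 - r.1.1 : ℕ)

variable {p : ℕ} [hp : Fact p.Prime] [CharP k p] {E : ℕ → Submodule k B} {d : ℕ}
  {φ : strictUpper k n →ₗ⁅k⁆ B}

theorem logMatrix_mem_band {g : Matrix (Fin n) (Fin n) R} (hg : g - 1 ∈ band n R 1) :
    logMatrix k p g ∈ band n R 1 := by
  rw [logMatrix, logPoly, map_sum]
  refine sum_mem fun j hj => ?_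
  rw [map_mul, aeval_C, map_pow, aeval_X, ← Algebra.smul_def, ← algebraMap_smul R]
  exact Submodule.smul_mem _ _ (band_antitone (Finset.mem_Icc.1 hj).1 (pow_mem_band hg j))

theorem extend_mem_tensorFil (hE : IsNilFiltration E d) (hφ : IsAdapted E φ)
    (M : Matrix (Fin n) (Fin n) R) : extend φ R M ∈ tensorFil E R 1 := by
  rw [extend_apply]
  refine sum_mem fun r _ => Submodule.subset_span ⟨_, hE.antitone ?_ (hφ r), _, rfl⟩
  have := r.2
  omega

theorem extend_pow_eq_zero (hE : IsNilFiltration E d) (hφ : IsAdapted E φ) (hd : d ≤ p)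
    (M : Matrix (Fin n) (Fin n) R) : extend φ R M ^ p = 0 :=
  eq_zero_of_mem_tensorFil hE hd (tensorFil_pow_mem hE (extend_mem_tensorFil hE hφ M) p)

theorem expRep_mul_expRepInv (hE : IsNilFiltration E d) (hφ : IsAdapted E φ) (hd : d ≤ p)
    (g : Matrix (Fin n) (Fin n) R) : expRep p φ g * expRepInv p φ g = 1 :=
  aeval_expPoly_mul_aeval_expInvPoly (extend_pow_eq_zero hE hφ hd _)

theorem expRepInv_mul_expRep (hE : IsNilFiltration E d) (hφ : IsAdapted E φ) (hd : d ≤ p)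
    (g : Matrix (Fin n) (Fin n) R) : expRepInv p φ g * expRep p φ g = 1 :=
  aeval_expInvPoly_mul_aeval_expPoly (extend_pow_eq_zero hE hφ hd _)

theorem coeffMap_expRep {R' : Type*} [CommRing R'] [Algebra k R'] (u : R →ₐ[k] R')
    (g : Matrix (Fin n) (Fin n) R) : coeffMap B u (expRep p φ g) = expRep p φ (g.map u) := by
  have h1 : (logMatrix k p g).map u = logMatrix k p (g.map u) := by
    have := aeval_algHom_apply u.mapMatrix (g - 1) (logPoly k p)
    rw [logMatrix, logMatrix, ← AlgHom.mapMatrix_apply, ← this, map_sub, map_one]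
    rfl
  rw [expRep, ← aeval_algHom_apply, expRep, ← h1, coeffMap_apply, lTensor_extend]
  rfl

theorem expRep_one : expRep p φ (1 : Matrix (Fin n) (Fin n) R) = 1 := by
  have h : logMatrix k p (1 : Matrix (Fin n) (Fin n) R) = 0 := by
    rw [logMatrix, sub_self, ← coeff_zero_eq_aeval_zero', coeff_zero_logPoly, map_zero]
  have h1 : (expPoly k p).coeff 0 = 1 := by
    have := X_dvd_iff.1 (X_dvd_one_sub_expPoly (k := k) (p := p))
    rw [coeff_sub, coeff_one_zero, sub_eq_zero] at this
    exact this.symm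
  rw [expRep, h, map_zero, ← coeff_zero_eq_aeval_zero', h1, map_one]

theorem mapMatrix_derivation_mul (D : Derivation k R R) (M N : Matrix (Fin n) (Fin n) R) :
    (D : R →ₗ[k] R).mapMatrix (M * N) =
      (D : R →ₗ[k] R).mapMatrix M * N + M * (D : R →ₗ[k] R).mapMatrix N := by
  ext i j
  simp only [LinearMap.mapMatrix_apply, Matrix.map_apply, Matrix.mul_apply, Matrix.add_apply,
    map_sum, ← Finset.sum_add_distrib]
  refine Finset.sum_congr rfl fun l _ => ?_
  simp only [Derivation.coeFn_coe, Derivation.leibniz, smul_eq_mul]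
  ring

/-- If `D g = g M` then `D (e^{φ(log g)}) = e^{φ(log g)} φ(M)`. -/
theorem lTensor_derivation_expRep (hE : IsNilFiltration E d) (hφ : IsAdapted E φ) (hd : d ≤ p)
    (hn : n ≤ p) (D : Derivation k R R) {g M : Matrix (Fin n) (Fin n) R}
    (hg : g - 1 ∈ band n R 1) (hM : g.map D = g * M) :
    (D : R →ₗ[k] R).lTensor B (expRep p φ g) = expRep p φ g * extend φ R M := by
  set Z := logMatrix k p g with hZdef
  have hZ : Z ∈ band n R 1 := logMatrix_mem_band hg
  have hDZ : (D : R →ₗ[k] R).mapMatrix Z ∈ band n R 1 := map_mem_band hZ (map_zero _)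
  have hgZ : aeval Z (expPoly k p) = g := by
    rw [hZdef, logMatrix, aeval_expPoly_aeval_logPoly, add_sub_cancel]
    exact eq_zero_of_mem_band hn (pow_mem_band hg p)
  have hp0 := hp.out.pos
  have h1 := map_aeval_expPoly (p := p) (mapMatrix_derivation_mul D) (Z := Z) fun a b hab =>
    eq_zero_of_mem_band (by omega) (mul_mem_band (mul_mem_band (pow_mem_band hZ a) hDZ)
      (pow_mem_band hZ b))
  rw [hgZ] at h1
  obtain ⟨g', -, -, hg'⟩ := exists_inverse hg
  -- Since `g = e^Z`, the derivative formula in the matrix algebra computes `g⁻¹ D g`.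
  have h2 : M = dexp k p Z ((D : R →ₗ[k] R).mapMatrix Z) := by
    have h3 : g * M = g * dexp k p Z ((D : R →ₗ[k] R).mapMatrix Z) := hM.symm.trans h1
    rw [← one_mul M, ← hg', mul_assoc, h3, ← mul_assoc, hg', one_mul]
  -- The Lie homomorphism carries this expression to `B ⊗ R`, where the derivative formula is used a
  -- second time, now in the opposite direction.
  have h4 : extend φ R M = dexp k p (extend φ R Z) ((D : R →ₗ[k] R).lTensor B (extend φ R Z)) := by
    rw [h2, lTensor_extend]
    refine map_dexp (L := band n R 1) (fun Y hY => ⟨?_, extend_lie φ hZ hY⟩) hDZ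
    exact sub_mem (band_antitone (by omega) (mul_mem_band hZ hY))
      (band_antitone (by omega) (mul_mem_band hY hZ))
  rw [h4, expRep]
  refine map_aeval_expPoly (p := p) (lTensor_derivation_mul D) fun a b hab => ?_
  have h5 : (D : R →ₗ[k] R).lTensor B (extend φ R Z) ∈ tensorFil E R 1 := by
    rw [lTensor_extend]
    exact extend_mem_tensorFil hE hφ _
  have h6 := extend_mem_tensorFil hE hφ Z
  exact eq_zero_of_mem_tensorFil hE (by omega) (tensorFil_mul_mem hE (tensorFil_mul_mem hE
    (tensorFil_pow_mem hE h6 a) h5) (tensorFil_pow_mem hE h6 b))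

/-- Two solutions of the linear equation `D y = y c` differ by a left factor killed by `D`, since `D
(y⁻¹) = -c y⁻¹`. -/
theorem derivation_mul_inverse_eq_zero {S : Type*} [Ring S] [Algebra k S] {D : S →ₗ[k] S}
    (hD : ∀ a b, D (a * b) = D a * b + a * D b) {x y y' c : S} (h1 : y * y' = 1)
    (h2 : y' * y = 1) (hx : D x = x * c) (hy : D y = y * c) : D (x * y') = 0 := by
  have h3 : D 1 = 0 := by simpa using hD 1 1
  have h4 : D y' = -(c * y') := by
    have h5 := hD y y'
    rw [h1, h3, hy] at h5
    have h6 : y * D y' = -(y * c * y') := (neg_eq_of_add_eq_zero_right h5.symm).symm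
    rw [← one_mul (D y'), ← h2, mul_assoc, h6, mul_neg, ← mul_assoc, ← mul_assoc, h2, one_mul]
  rw [hD, hx, h4]
  noncomm_ring

end ExpRep

/-! ### Multiplicativity of `g ↦ e^{φ(log g)}`. -/

section Multiplicativity

open MvPolynomial

variable {k : Type*} [Field k] {n : ℕ} {B : Type*} [Ring B] [Algebra k B]

/-- The generic unipotent matrix over `K`. -/
noncomputable def genericMatrix (K : Type*) [CommRing K] (n : ℕ) :
    Matrix (Fin n) (Fin n) (MvPolynomial (Pos n) K) :=
  Matrix.of fun i j => if h : i < j then X ⟨(i, j), h⟩ else if i = j then 1 else 0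

variable {K : Type*} [CommRing K] [Algebra k K]

theorem genericMatrix_apply (r : Pos n) : genericMatrix K n r.1.1 r.1.2 = X r := by
  simp [genericMatrix, r.2]

theorem genericMatrix_sub_one_mem : genericMatrix K n - 1 ∈ band n _ 1 := by
  intro i j hij
  have h : ¬ i < j := by omega
  by_cases h' : i = j
  · subst h'; simp [genericMatrix]
  · simp [genericMatrix, h, h']

theorem genericMatrix_map {R : Type*} [CommRing R] {F : Type*}
    [FunLike F (MvPolynomial (Pos n) K) R] [RingHomClass F (MvPolynomial (Pos n) K) R] (u : F)
    {h : Matrix (Fin n) (Fin n) R} (hh : h - 1 ∈ band n R 1)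
    (hu : ∀ r : Pos n, u (X r) = h r.1.1 r.1.2) : (genericMatrix K n).map u = h := by
  ext i j
  rw [Matrix.map_apply, genericMatrix, Matrix.of_apply]
  split_ifs with h1 h2
  · exact hu _
  · subst h2
    have := hh i i (by omega)
    rw [Matrix.sub_apply, Matrix.one_apply_eq, sub_eq_zero] at this
    rw [map_one, this]
  · have := hh i j (by omega)
    rw [Matrix.sub_apply, Matrix.one_apply_ne h2, sub_zero] at this
    rw [map_zero, this]

theorem genericMatrix_map_derivation {R₀ : Type*} [CommRing R₀]
    [Algebra R₀ (MvPolynomial (Pos n) K)]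
    (D : Derivation R₀ (MvPolynomial (Pos n) K) (MvPolynomial (Pos n) K))
    {N : Matrix (Fin n) (Fin n) (MvPolynomial (Pos n) K)} (hN : N ∈ band n _ 1)
    (hD : ∀ r : Pos n, D (X r) = N r.1.1 r.1.2) : (genericMatrix K n).map D = N := by
  ext1 i j
  rw [Matrix.map_apply, genericMatrix, Matrix.of_apply]
  split_ifs with h1 h2
  · exact hD _
  · rw [Derivation.map_one_eq_zero, hN i j (by omega)]
  · rw [map_zero, hN i j (by omega)]

/-- Upper triangular matrices over `K[σ]` whose `(i, j)` entry has degree at most `j - i`. -/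
noncomputable def degBand (k : Type*) [Field k] (n : ℕ) (σ K : Type*) [CommRing K] [Algebra k K] :
    Subalgebra k (Matrix (Fin n) (Fin n) (MvPolynomial σ K)) where
  carrier := {M | M ∈ band n _ 0 ∧ ∀ i j : Fin n, (M i j).totalDegree ≤ j - i}
  mul_mem' := by
    rintro M N ⟨hM, hM'⟩ ⟨hN, hN'⟩
    refine ⟨mul_mem_band hM hN, fun i j => ?_⟩
    rw [Matrix.mul_apply]
    refine totalDegree_finsetSum_le fun l _ => ?_
    by_cases h1 : (l : ℕ) < i
    · rw [hM i l (by omega), zero_mul, totalDegree_zero]; omega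
    by_cases h2 : (j : ℕ) < l
    · rw [hN l j (by omega), mul_zero, totalDegree_zero]; omega
    refine (totalDegree_mul _ _).trans ((add_le_add (hM' i l) (hN' l j)).trans ?_)
    omega
  add_mem' := by
    rintro M N ⟨hM, hM'⟩ ⟨hN, hN'⟩
    exact ⟨add_mem hM hN, fun i j => (totalDegree_add _ _).trans (max_le (hM' i j) (hN' i j))⟩
  algebraMap_mem' := by
    intro c
    refine ⟨?_, fun i j => ?_⟩
    · rw [Algebra.algebraMap_eq_smul_one, ← algebraMap_smul (MvPolynomial σ K)]
      exact Submodule.smul_mem _ _ one_mem_band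
    · rw [Matrix.algebraMap_matrix_apply]
      split_ifs
      · rw [IsScalarTower.algebraMap_apply k K, MvPolynomial.algebraMap_eq, totalDegree_C]
        omega
      · rw [totalDegree_zero]
        omega

theorem genericMatrix_mem_degBand : genericMatrix K n ∈ degBand k n (Pos n) K := by
  refine ⟨?_, fun i j => ?_⟩
  · rw [← sub_add_cancel (genericMatrix K n) 1]
    exact add_mem (band_antitone (by omega) genericMatrix_sub_one_mem) one_mem_band
  · rw [genericMatrix, Matrix.of_apply]
    split_ifs with h1 h2
    · refine (totalDegree_monomial_le _ _).trans ?_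
      simp
      omega
    · simp
    · simp

theorem map_C_mem_degBand {σ : Type*} {g : Matrix (Fin n) (Fin n) K} (hg : g ∈ band n K 0) :
    g.map (C : K → MvPolynomial σ K) ∈ degBand k n σ K :=
  ⟨map_mem_band hg (map_zero _), fun i j => by simp⟩

variable {p : ℕ} [hp : Fact p.Prime] [CharP k p] {E : ℕ → Submodule k B} {d : ℕ}
  {φ : strictUpper k n →ₗ⁅k⁆ B}

theorem extend_log_mem_degFil (hφ : IsAdapted E φ) {σ : Type*}
    {g : Matrix (Fin n) (Fin n) (MvPolynomial σ K)} (hg : g ∈ degBand k n σ K) :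
    extend φ _ (logMatrix k p g) ∈ degFil E σ K := by
  have h1 : logMatrix k p g ∈ degBand k n σ K :=
    aeval_mem_subalgebra (sub_mem hg (one_mem _)) _
  rw [extend_apply]
  exact sum_mem fun r _ => Submodule.subset_span ⟨_, _, hφ r, _, h1.2 _ _, rfl⟩

theorem expRep_mem_degFil (hE : IsNilFiltration E d) (hφ : IsAdapted E φ) {σ : Type*}
    {g : Matrix (Fin n) (Fin n) (MvPolynomial σ K)} (hg : g ∈ degBand k n σ K) :
    expRep p φ g ∈ degFilSubalgebra hE σ K :=
  aeval_mem_subalgebra (T := degFilSubalgebra hE σ K) (extend_log_mem_degFil hφ hg) _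

theorem expRepInv_mem_degFil (hE : IsNilFiltration E d) (hφ : IsAdapted E φ) {σ : Type*}
    {g : Matrix (Fin n) (Fin n) (MvPolynomial σ K)} (hg : g ∈ degBand k n σ K) :
    expRepInv p φ g ∈ degFilSubalgebra hE σ K :=
  aeval_mem_subalgebra (T := degFilSubalgebra hE σ K) (extend_log_mem_degFil hφ hg) _

/-- With `g` constant and `h` generic, the quotient `G` of the exponentials at `gh` and `h` has zero
partial derivatives and degree at most `d - 1 < p`. It is thus constant in `h`, and its value at `h
= 1` is the exponential at `g`. -/
theorem expRep_mul_generic (hE : IsNilFiltration E d) (hφ : IsAdapted E φ) (hd : d ≤ p)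
    (hn : n ≤ p) {g : Matrix (Fin n) (Fin n) K} (hg : g - 1 ∈ band n K 1) :
    expRep p φ (g.map C * genericMatrix K n) =
      coeffMap B (constants k (Pos n) K) (expRep p φ g) * expRep p φ (genericMatrix K n) := by
  set h := genericMatrix K n with hh
  have hp0 := hp.out.pos
  have hh1 : h - 1 ∈ band n _ 1 := genericMatrix_sub_one_mem
  have hg0 : g ∈ band n K 0 := by
    rw [← sub_add_cancel g 1]
    exact add_mem (band_antitone (by omega) hg) one_mem_band
  have hgC : g.map C - 1 ∈ band n (MvPolynomial (Pos n) K) 1 := by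
    have := map_mem_band hg (map_zero (C : K →+* MvPolynomial (Pos n) K))
    rwa [Matrix.map_sub _ (map_sub _), Matrix.map_one _ (map_zero _) (map_one _)] at this
  have hdB : h ∈ degBand k n (Pos n) K := genericMatrix_mem_degBand
  set G := expRep p φ (g.map C * h) * expRepInv p φ h with hG
  have hmem : G ∈ degLE k B (Pos n) K (d - 1) := degFil_le_degLE hE <|
    (degFilSubalgebra hE _ _).mul_mem (expRep_mem_degFil hE hφ
      (mul_mem (map_C_mem_degBand hg0) hdB)) (expRepInv_mem_degFil hE hφ hdB)
  have hconst := eq_constant_of_pderiv_eq_zero (p := p) (by omega) hmem fun r => by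
    obtain ⟨h', hh0, hh', -⟩ := exists_inverse hh1
    set D : Derivation k (MvPolynomial (Pos n) K) (MvPolynomial (Pos n) K) :=
      (pderiv r).restrictScalars k
    -- The partial derivative of `h` in direction `r` is the matrix unit `ε_r`, so `M = h⁻¹ ε_r`
    -- solves `D h = h M`. The same `M` serves for `gh` because `D` kills the entries of `g`.
    set M := h' * Matrix.single r.1.1 r.1.2 1
    have hM : h.map D = h * M := by
      rw [← mul_assoc, hh', one_mul]
      refine genericMatrix_map_derivation D (single_mem_band r 1) fun s => ?_
      change pderiv r (X s) = _
      classical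
      rw [pderiv_X, Matrix.single_apply, Pi.single_apply]
      congr 1
      rw [eq_iff_iff, Subtype.ext_iff, Prod.ext_iff]
      exact ⟨fun h => ⟨h.1.symm, h.2.symm⟩, fun h => ⟨h.1.symm, h.2.symm⟩⟩
    have hM' : (g.map C * h).map D = (g.map C * h) * M := by
      have h1 := mapMatrix_derivation_mul D (g.map C) h
      have h2 : (D : MvPolynomial (Pos n) K →ₗ[k] MvPolynomial (Pos n) K).mapMatrix (g.map C) = 0 := by
        ext1 i j
        exact pderiv_C
      rw [h2, zero_mul, zero_add] at h1
      rw [mul_assoc, ← hM]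
      exact h1
    exact derivation_mul_inverse_eq_zero (lTensor_derivation_mul D)
      (expRep_mul_expRepInv hE hφ hd h) (expRepInv_mul_expRep hE hφ hd h)
      (lTensor_derivation_expRep hE hφ hd hn D (mul_sub_one_mem_band hgC hh1) hM')
      (lTensor_derivation_expRep hE hφ hd hn D hh1 hM)
  have heval : coeffMap B (evalZero k (Pos n) K) G = expRep p φ g := by
    have h1 : h.map (evalZero k (Pos n) K) = 1 :=
      genericMatrix_map _ (by simp) fun r => by
        rw [Matrix.one_apply_ne r.2.ne]
        simp [evalZero]
    have h2 : (g.map C * h).map (evalZero k (Pos n) K) = g := by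
      rw [Matrix.map_mul, h1, mul_one, Matrix.map_map]
      ext i j
      simp [evalZero]
    have h3 := congrArg (coeffMap B (evalZero k (Pos n) K)) (expRep_mul_expRepInv hE hφ hd h)
    rw [map_mul, coeffMap_expRep, h1, expRep_one, one_mul, map_one] at h3
    rw [hG, map_mul, h3, mul_one, coeffMap_expRep, h2]
  rw [heval] at hconst
  rw [← hconst, hG, mul_assoc, expRepInv_mul_expRep hE hφ hd, mul_one]

/-- `g ↦ e^{φ(log g)}` is multiplicative. -/
theorem expRep_mul (hE : IsNilFiltration E d) (hφ : IsAdapted E φ) (hd : d ≤ p)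
    (hn : n ≤ p) {g h : Matrix (Fin n) (Fin n) K} (hg : g - 1 ∈ band n K 1)
    (hh : h - 1 ∈ band n K 1) : expRep p φ (g * h) = expRep p φ g * expRep p φ h := by
  -- The generic matrix is specialised to `h`.
  let u : MvPolynomial (Pos n) K →ₐ[k] K :=
    (aeval (R := K) fun r : Pos n => h r.1.1 r.1.2).restrictScalars k
  have h1 : (genericMatrix K n).map u = h := genericMatrix_map u hh fun r => by simp [u]
  have h2 : (g.map C).map u = g := by
    rw [Matrix.map_map]
    ext i j
    simp [u]
  have h3 := congrArg (coeffMap B u) (expRep_mul_generic hE hφ hd hn hg)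
  have h4 : g.map (constants k (Pos n) K) = g.map C := rfl
  rwa [map_mul, coeffMap_expRep, coeffMap_expRep, coeffMap_expRep, coeffMap_expRep, Matrix.map_mul,
    h4, h1, h2] at h3

end Multiplicativity

/-! ### The Hopf algebra of `U_n`: Frobenius and invariant derivations. -/

section Hopf

open MvPolynomial

variable {k : Type*} [Field k] {n : ℕ}

/-- `a ↦ a ⊗ 1`. -/
noncomputable abbrev inclLeft (k : Type*) [Field k] (n : ℕ) :
    CoordRing k n →ₐ[k] CoordRing k n ⊗[k] CoordRing k n :=
  Algebra.TensorProduct.includeLeft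

/-- `a ↦ 1 ⊗ a`. -/
noncomputable abbrev inclRight (k : Type*) [Field k] (n : ℕ) :
    CoordRing k n →ₐ[k] CoordRing k n ⊗[k] CoordRing k n :=
  Algebra.TensorProduct.includeRight

theorem generic_apply (r : Pos n) : generic k n r.1.1 r.1.2 = X r := genericMatrix_apply r

theorem generic_sub_one_mem : generic k n - 1 ∈ band n _ 1 := genericMatrix_sub_one_mem

theorem generic_map_sub_one_mem {R : Type*} [CommRing R] [Algebra k R] (u : CoordRing k n →ₐ[k] R) :
    (generic k n).map u - 1 ∈ band n _ 1 := by
  have := map_mem_band (generic_sub_one_mem (k := k) (n := n)) (map_zero u)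
  rwa [Matrix.map_sub _ (map_sub _), Matrix.map_one _ (map_zero _) (map_one _)] at this

theorem comul_X (r : Pos n) : comul k n (X r) =
    ∑ l, generic k n r.1.1 l ⊗ₜ[k] generic k n l r.1.2 := by
  obtain ⟨⟨i, j⟩, hij⟩ := r
  have h1 : ∑ l, generic k n i l ⊗ₜ[k] generic k n l j =
      ∑ l ∈ Finset.Icc i j, generic k n i l ⊗ₜ[k] generic k n l j := by
    refine (Finset.sum_subset (Finset.subset_univ _) fun l _ hl => ?_).symm
    rw [Finset.mem_Icc, not_and_or, not_le, not_le] at hl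
    rcases hl with hl | hl
    · have : generic k n i l = 0 := by simp [generic, hl.not_gt, hl.ne']
      rw [this, TensorProduct.zero_tmul]
    · have : generic k n l j = 0 := by simp [generic, hl.not_gt, hl.ne']
      rw [this, TensorProduct.tmul_zero]
  have hii : ∀ l, generic k n l l = 1 := fun l => by simp [generic]
  have hX : generic k n i j = X ⟨(i, j), hij⟩ := generic_apply ⟨(i, j), hij⟩
  rw [h1, ← Finset.Ico_insert_right hij.le, Finset.sum_insert (by simp),
    ← Finset.Ioo_insert_left hij, Finset.sum_insert (by simp), comul, aeval_X, hii, hii, hX]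
  abel

theorem generic_map_comul : (generic k n).map (comul k n) =
    (generic k n).map (inclLeft k n) * (generic k n).map (inclRight k n) := by
  refine genericMatrix_map _ (mul_sub_one_mem_band (generic_map_sub_one_mem _)
    (generic_map_sub_one_mem _)) fun r => ?_
  rw [comul_X, Matrix.mul_apply]
  simp

theorem generic_map_counit : (generic k n).map (counit k n) = 1 :=
  genericMatrix_map _ (by simp) fun r => by simp [counit, Matrix.one_apply_ne r.2.ne]

variable {p : ℕ} [hp : Fact p.Prime] [CharP k p]

theorem sum_pow_of_algebra (k : Type*) [Field k] (p : ℕ) [hp : Fact p.Prime] [CharP k p]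
    {R : Type*} [CommRing R] [Algebra k R] {ι : Type*} (s : Finset ι) (f : ι → R) :
    (∑ i ∈ s, f i) ^ p = ∑ i ∈ s, f i ^ p := by
  rcases subsingleton_or_nontrivial R with h | h
  · exact Subsingleton.elim _ _
  · have : CharP R p := charP_of_injective_algebraMap (algebraMap k R).injective p
    exact sum_pow_char p s f

/-- On generators this is the additivity of the `p`-th power in `A ⊗ A`, because the
comultiplication of `x_{ij}` has coefficients in the prime field. -/
theorem comul_expand (a : CoordRing k n) : comul k n (expand p a) =
    Algebra.TensorProduct.map (expand p) (expand p) (comul k n a) := by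
  have hg : ∀ i j, expand p (generic k n i j) = generic k n i j ^ p := by
    intro i j
    rw [generic, Matrix.of_apply]
    split_ifs
    · simp
    · simp
    · simp [hp.out.ne_zero]
  suffices h : (comul k n).comp (expand p) =
      (Algebra.TensorProduct.map (expand p) (expand p)).comp (comul k n) from
    DFunLike.congr_fun h a
  refine algHom_ext fun r => ?_
  rw [AlgHom.comp_apply, AlgHom.comp_apply, expand_X, map_pow, comul_X,
    sum_pow_of_algebra k p, map_sum]
  refine Finset.sum_congr rfl fun l _ => ?_
  rw [Algebra.TensorProduct.tmul_pow, Algebra.TensorProduct.map_tmul, hg, hg]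

theorem counit_expand (a : CoordRing k n) : counit k n (expand p a) = counit k n a := by
  suffices h : (counit k n).comp (expand p) = counit k n from DFunLike.congr_fun h a
  refine algHom_ext fun r => ?_
  simp [counit, hp.out.ne_zero]

/-- The left invariant derivation `D` of `A_n` with `D g = g X`. -/
noncomputable def invDeriv (X : Matrix (Fin n) (Fin n) k) :
    Derivation k (CoordRing k n) (CoordRing k n) :=
  mkDerivation k fun r => (generic k n * X.map (algebraMap k (CoordRing k n))) r.1.1 r.1.2

theorem map_algebraMap_mem_band (R : Type*) [CommRing R] [Algebra k R] (X : strictUpper k n) :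
    (X : Matrix (Fin n) (Fin n) k).map (algebraMap k R) ∈ band n R 1 :=
  map_mem_band (f := algebraMap k R) (fun i j hij => X.2 i j (by omega)) (map_zero _)

theorem generic_mem_band_zero : generic k n ∈ band n _ 0 := by
  rw [← sub_add_cancel (generic k n) 1]
  exact add_mem (band_antitone (by omega) generic_sub_one_mem) one_mem_band

theorem generic_map_invDeriv (X : strictUpper k n) : (generic k n).map (invDeriv X.1) =
    generic k n * X.1.map (algebraMap k (CoordRing k n)) := by
  refine genericMatrix_map_derivation (invDeriv X.1) (N := generic k n * X.1.map (algebraMap k _))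
    ?_ fun r => mkDerivation_X ..
  have := mul_mem_band generic_mem_band_zero (map_algebraMap_mem_band (CoordRing k n) X)
  rwa [zero_add] at this

theorem mul_map_invDeriv (X : strictUpper k n) (Y : Matrix (Fin n) (Fin n) k) :
    (generic k n * Y.map (algebraMap k (CoordRing k n))).map (invDeriv X.1) =
      generic k n * (X.1 * Y).map (algebraMap k (CoordRing k n)) := by
  have h1 := mapMatrix_derivation_mul (invDeriv X.1) (generic k n)
    (Y.map (algebraMap k (CoordRing k n)))
  have h2 : (invDeriv X.1 : CoordRing k n →ₗ[k] CoordRing k n).mapMatrix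
      (Y.map (algebraMap k (CoordRing k n))) = 0 := by
    ext1 i j
    simp
  rw [h2, mul_zero, add_zero] at h1
  refine h1.trans ?_
  rw [Matrix.map_mul, ← mul_assoc, ← generic_map_invDeriv]
  rfl

theorem invDeriv_add (X Y : Matrix (Fin n) (Fin n) k) :
    invDeriv (X + Y) = invDeriv X + invDeriv Y := by
  refine derivation_ext fun r => ?_
  simp [invDeriv, Matrix.map_add, mul_add]

theorem invDeriv_smul (c : k) (X : Matrix (Fin n) (Fin n) k) :
    invDeriv (c • X) = c • invDeriv X := by
  refine derivation_ext fun r => ?_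
  have : (c • X).map (algebraMap k (CoordRing k n)) = c • X.map (algebraMap k (CoordRing k n)) := by
    ext1 i j
    rw [Matrix.map_apply, Matrix.smul_apply, Matrix.smul_apply, smul_eq_mul, map_mul,
      ← Algebra.smul_def, Matrix.map_apply]
  rw [invDeriv, mkDerivation_X, Derivation.smul_apply, invDeriv, mkDerivation_X, this,
    mul_smul_comm, Matrix.smul_apply]

/-- Derivations are compared on the entries of `g`: applying `D_Y` and then `D_X` sends `g` to `g X
Y`, so the order of the factors is preserved. -/
theorem invDeriv_lie (X Y : strictUpper k n) (a : CoordRing k n) :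
    invDeriv (⁅X, Y⁆ : strictUpper k n).1 a =
      invDeriv X.1 (invDeriv Y.1 a) - invDeriv Y.1 (invDeriv X.1 a) := by
  have h : invDeriv (⁅X, Y⁆ : strictUpper k n).1 = ⁅invDeriv X.1, invDeriv Y.1⁆ := by
    refine derivation_ext fun r => ?_
    rw [Derivation.commutator_apply]
    have h1 : ∀ Z : strictUpper k n, invDeriv Z.1 (MvPolynomial.X r) =
        (generic k n * Z.1.map (algebraMap k (CoordRing k n))) r.1.1 r.1.2 := fun Z =>
      mkDerivation_X ..
    have h2 : ∀ Z Z' : strictUpper k n, invDeriv Z.1 (invDeriv Z'.1 (MvPolynomial.X r)) =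
        (generic k n * (Z.1 * Z'.1).map (algebraMap k (CoordRing k n))) r.1.1 r.1.2 := by
      intro Z Z'
      rw [h1, ← mul_map_invDeriv]
      rfl
    rw [h1, h2, h2, ← Matrix.sub_apply, ← mul_sub, ← Matrix.map_sub _ (map_sub _)]
    rfl
  rw [h, Derivation.commutator_apply]

/-- On `R ⊗ R` the operators `D ⊗ 1` and `1 ⊗ D` commute, so the `p`-th power of their sum is the
sum of their `p`-th powers in characteristic `p`. Multiplication `R ⊗ R → R` carries this to the
Leibniz rule for `D ^ p`. -/
theorem derivation_pow_char_mul {R : Type*} [CommRing R] [Algebra k R] (D : Derivation k R R)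
    (a b : R) : ((D : Module.End k R) ^ p) (a * b) =
      ((D : Module.End k R) ^ p) a * b + a * ((D : Module.End k R) ^ p) b := by
  set d : Module.End k R := (D : Module.End k R)
  let u : Module.End k (R ⊗[k] R) := d.rTensor R
  let v : Module.End k (R ⊗[k] R) := d.lTensor R
  let μ : R ⊗[k] R →ₗ[k] R := LinearMap.mul' k R
  have huv : Commute u v := by
    change u ∘ₗ v = v ∘ₗ u
    rw [LinearMap.rTensor_comp_lTensor, LinearMap.lTensor_comp_rTensor]
  have hμ : ∀ x, d (μ x) = μ ((u + v) x) := by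
    intro x
    induction x with
    | zero => simp
    | add x y hx hy => simp only [map_add, hx, hy]
    | tmul a b => simp [u, v, μ, d, mul_comm, add_comm]
  have hpow : ∀ m x, (d ^ m) (μ x) = μ (((u + v) ^ m) x) := by
    intro m
    induction m with
    | zero => simp
    | succ m ih =>
      intro x
      rw [pow_succ, Module.End.mul_apply, hμ, ih, pow_succ, Module.End.mul_apply]
  have hu : ∀ m, (u ^ m) (a ⊗ₜ b) = (d ^ m) a ⊗ₜ b := by
    intro m
    rw [LinearMap.rTensor_pow]; rfl
  have hv : ∀ m, (v ^ m) (a ⊗ₜ b) = a ⊗ₜ (d ^ m) b := by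
    intro m
    rw [LinearMap.lTensor_pow]; rfl
  obtain ⟨r, hr⟩ := huv.exists_add_pow_prime_eq hp.out
  have h0 : (p : Module.End k (R ⊗[k] R)) = 0 := by
    rw [← map_natCast (algebraMap k (Module.End k (R ⊗[k] R))), CharP.cast_eq_zero, map_zero]
  have := hpow p (a ⊗ₜ b)
  rw [hr] at this
  simpa [h0, hu, hv, μ] using this

/-- The `p`-th power obeys the Leibniz rule and sends `g` to `g X ^ p`, where `X ^ p = 0` because `n
≤ p`. -/
theorem invDeriv_pow_char (hn : n ≤ p) (X : strictUpper k n) :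
    (invDeriv X.1 : Module.End k (CoordRing k n)) ^ p = 0 := by
  have hX : ∀ m, 0 < m → ∀ r : Pos n, ((invDeriv X.1 : Module.End k (CoordRing k n)) ^ m)
      (MvPolynomial.X r) =
        (generic k n * (X.1 ^ m).map (algebraMap k (CoordRing k n))) r.1.1 r.1.2 := by
    intro m hm
    induction m, hm using Nat.le_induction with
    | base => intro r; rw [pow_one, pow_one]; exact mkDerivation_X ..
    | succ m _ ih =>
      intro r
      rw [pow_succ', Module.End.mul_apply, ih, pow_succ', ← mul_map_invDeriv]
      rfl
  refine LinearMap.ext fun f => ?_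
  induction f using MvPolynomial.induction_on with
  | C c =>
    obtain ⟨q, rfl⟩ : ∃ q, p = q + 1 := ⟨p - 1, by have := hp.out.pos; omega⟩
    rw [pow_succ, Module.End.mul_apply]
    simp
  | add f g hf hg => rw [map_add, hf, hg]; simp
  | mul_X f r hf =>
    have h0 : X.1 ^ p = 0 := eq_zero_of_mem_band hn
      (pow_mem_band (fun i j hij => X.2 i j (by omega)) p)
    rw [derivation_pow_char_mul, hf, hX p hp.out.pos, h0]
    simp

end Hopf

/-! ### Representations as elements of `B ⊗ A_n`, and their differentials. -/

section RepElement

open MvPolynomial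

variable {k : Type*} [Field k] {n : ℕ} {B : Type*} [Ring B] [Algebra k B]

/-- The value at the identity of `U_n`. -/
noncomputable def evalOne (k : Type*) [Field k] (n : ℕ) (B : Type*) [Ring B] [Algebra k B] :
    B ⊗[k] CoordRing k n →ₐ[k] B :=
  (Algebra.TensorProduct.rid k k B).toAlgHom.comp (coeffMap B (counit k n))

@[simp]
theorem evalOne_tmul (b : B) (a : CoordRing k n) :
    evalOne k n B (b ⊗ₜ[k] a) = counit k n a • b := by
  simp [evalOne]

/-- `Θ` is the matrix formula of a representation: `Θ(gh) = Θ(g)Θ(h)` and `Θ(1) = 1`. -/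
structure IsRepElement (Θ : B ⊗[k] CoordRing k n) : Prop where
  comul_eq : coeffMap B (comul k n) Θ =
    coeffMap B (inclLeft k n) Θ * coeffMap B (inclRight k n) Θ
  evalOne_eq : evalOne k n B Θ = 1

/-- Evaluation of the second factor at the identity. -/
noncomputable def projLeft (k : Type*) [Field k] (n : ℕ) :
    CoordRing k n ⊗[k] CoordRing k n →ₐ[k] CoordRing k n :=
  Algebra.TensorProduct.productMap (AlgHom.id k _) ((Algebra.ofId k _).comp (counit k n))

/-- Evaluation of the first factor at the identity. -/
noncomputable def projRight (k : Type*) [Field k] (n : ℕ) :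
    CoordRing k n ⊗[k] CoordRing k n →ₐ[k] CoordRing k n :=
  Algebra.TensorProduct.productMap ((Algebra.ofId k _).comp (counit k n)) (AlgHom.id k _)

@[simp]
theorem projLeft_tmul (a b : CoordRing k n) :
    projLeft k n (a ⊗ₜ[k] b) = counit k n b • a := by
  simp only [projLeft, Algebra.TensorProduct.productMap_apply_tmul, AlgHom.coe_id, id_eq,
    AlgHom.comp_apply, Algebra.ofId_apply]
  rw [mul_comm, ← Algebra.smul_def]

@[simp]
theorem projRight_tmul (a b : CoordRing k n) :
    projRight k n (a ⊗ₜ[k] b) = counit k n a • b := by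
  simp only [projRight, Algebra.TensorProduct.productMap_apply_tmul, AlgHom.coe_id, id_eq,
    AlgHom.comp_apply, Algebra.ofId_apply]
  rw [← Algebra.smul_def]

theorem counit_generic (i j : Fin n) : counit k n (generic k n i j) =
    (1 : Matrix (Fin n) (Fin n) k) i j :=
  congrFun (congrFun (generic_map_counit (k := k) (n := n)) i) j

theorem projLeft_comul (a : CoordRing k n) : projLeft k n (comul k n a) = a := by
  suffices h : (projLeft k n).comp (comul k n) = AlgHom.id k _ from DFunLike.congr_fun h a
  refine algHom_ext fun r => ?_
  rw [AlgHom.comp_apply, comul_X, map_sum]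
  simp only [projLeft_tmul, counit_generic, Matrix.one_apply, ite_smul, one_smul, zero_smul]
  simp [generic_apply]

theorem projRight_comul (a : CoordRing k n) : projRight k n (comul k n a) = a := by
  suffices h : (projRight k n).comp (comul k n) = AlgHom.id k _ from DFunLike.congr_fun h a
  refine algHom_ext fun r => ?_
  rw [AlgHom.comp_apply, comul_X, map_sum]
  simp only [projRight_tmul, counit_generic, Matrix.one_apply, ite_smul, one_smul, zero_smul]
  simp [generic_apply]

theorem counit_invDeriv (X : strictUpper k n) (i j : Fin n) :
    counit k n (invDeriv X.1 (generic k n i j)) = X.1 i j := by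
  have h := congrArg (fun M => M.map (counit k n)) (generic_map_invDeriv X)
  simp only [Matrix.map_mul, generic_map_counit, one_mul, Matrix.map_map] at h
  have h1 := congrFun (congrFun h i) j
  simpa using h1

/-- A derivation acting on the second factor. -/
noncomputable def derivRight (D : Derivation k (CoordRing k n) (CoordRing k n)) :
    Derivation k (CoordRing k n ⊗[k] CoordRing k n) (CoordRing k n ⊗[k] CoordRing k n) :=
  Derivation.mk' ((D : CoordRing k n →ₗ[k] CoordRing k n).lTensor (CoordRing k n)) fun a b => by
    rw [lTensor_derivation_mul, smul_eq_mul, smul_eq_mul, add_comm, mul_comm b]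

@[simp]
theorem derivRight_tmul (D : Derivation k (CoordRing k n) (CoordRing k n)) (a b : CoordRing k n) :
    derivRight D (a ⊗ₜ[k] b) = a ⊗ₜ[k] D b := rfl

/-- A derivation acting on the first factor. -/
noncomputable def derivLeft (D : Derivation k (CoordRing k n) (CoordRing k n)) :
    Derivation k (CoordRing k n ⊗[k] CoordRing k n) (CoordRing k n ⊗[k] CoordRing k n) :=
  Derivation.mk' ((D : CoordRing k n →ₗ[k] CoordRing k n).rTensor (CoordRing k n)) fun x y => by
    induction x with
    | zero => simp
    | add x x' hx hx' => simp only [add_mul, map_add, hx, hx', add_smul, smul_add]; abel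
    | tmul b r =>
      induction y with
      | zero => simp
      | add y y' hy hy' => simp only [mul_add, map_add, hy, hy', add_smul, smul_add]; abel
      | tmul c s =>
        simp only [Algebra.TensorProduct.tmul_mul_tmul, LinearMap.rTensor_tmul,
          Derivation.coeFn_coe, Derivation.leibniz, smul_eq_mul, TensorProduct.add_tmul]
        rw [mul_comm s r]

@[simp]
theorem derivLeft_tmul (D : Derivation k (CoordRing k n) (CoordRing k n)) (a b : CoordRing k n) :
    derivLeft D (a ⊗ₜ[k] b) = D a ⊗ₜ[k] b := rfl

/-- Left invariance: differentiating `a(gh)` in `h` at `h = 1` gives `(D a)(g)`. Both sides are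
derivations in `a`, so the entries of `g` suffice. -/
theorem invDeriv_eq_projLeft (X : strictUpper k n) (a : CoordRing k n) :
    invDeriv X.1 a = projLeft k n (derivRight (invDeriv X.1) (comul k n a)) := by
  let D' : Derivation k (CoordRing k n) (CoordRing k n) :=
    Derivation.mk' ((projLeft k n).toLinearMap ∘ₗ
      (derivRight (invDeriv X.1) : _ →ₗ[k] CoordRing k n ⊗[k] CoordRing k n) ∘ₗ
        (comul k n).toLinearMap) fun a b => by
      simp [projLeft_comul]
  suffices h : invDeriv X.1 = D' from DFunLike.congr_fun h a
  refine derivation_ext fun r => ?_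
  change _ = projLeft k n (derivRight (invDeriv X.1) (comul k n _))
  rw [comul_X, map_sum, map_sum]
  simp only [derivRight_tmul, projLeft_tmul, counit_invDeriv]
  rw [invDeriv, mkDerivation_X, Matrix.mul_apply]
  refine Finset.sum_congr rfl fun l _ => ?_
  rw [Matrix.map_apply, mul_comm, ← Algebra.smul_def]

/-- The differential of `Θ`. -/
noncomputable def differential (Θ : B ⊗[k] CoordRing k n) (X : strictUpper k n) : B :=
  evalOne k n B ((invDeriv X.1 : CoordRing k n →ₗ[k] CoordRing k n).lTensor B Θ)

theorem lTensor_derivRight_inclRight (D : Derivation k (CoordRing k n) (CoordRing k n))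
    (Θ : B ⊗[k] CoordRing k n) : (derivRight D : _ →ₗ[k] CoordRing k n ⊗[k] CoordRing k n).lTensor B
      (coeffMap B (inclRight k n) Θ) =
      coeffMap B (inclRight k n) ((D : CoordRing k n →ₗ[k] CoordRing k n).lTensor B Θ) := by
  induction Θ with
  | zero => simp
  | add x y hx hy => simp only [map_add, hx, hy]
  | tmul b a => simp

theorem lTensor_derivRight_inclLeft (D : Derivation k (CoordRing k n) (CoordRing k n))
    (Θ : B ⊗[k] CoordRing k n) : (derivRight D : _ →ₗ[k] CoordRing k n ⊗[k] CoordRing k n).lTensor B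
      (coeffMap B (inclLeft k n) Θ) = 0 := by
  induction Θ with
  | zero => simp
  | add x y hx hy => simp only [map_add, hx, hy, add_zero]
  | tmul b a => simp

theorem lTensor_derivLeft_inclLeft (D : Derivation k (CoordRing k n) (CoordRing k n))
    (Θ : B ⊗[k] CoordRing k n) : (derivLeft D : _ →ₗ[k] CoordRing k n ⊗[k] CoordRing k n).lTensor B
      (coeffMap B (inclLeft k n) Θ) =
      coeffMap B (inclLeft k n) ((D : CoordRing k n →ₗ[k] CoordRing k n).lTensor B Θ) := by
  induction Θ with
  | zero => simp
  | add x y hx hy => simp only [map_add, hx, hy]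
  | tmul b a => simp

theorem lTensor_derivLeft_inclRight (D : Derivation k (CoordRing k n) (CoordRing k n))
    (Θ : B ⊗[k] CoordRing k n) : (derivLeft D : _ →ₗ[k] CoordRing k n ⊗[k] CoordRing k n).lTensor B
      (coeffMap B (inclRight k n) Θ) = 0 := by
  induction Θ with
  | zero => simp
  | add x y hx hy => simp only [map_add, hx, hy, add_zero]
  | tmul b a => simp

theorem projLeft_inclLeft (Θ : B ⊗[k] CoordRing k n) :
    coeffMap B (projLeft k n) (coeffMap B (inclLeft k n) Θ) = Θ := by
  induction Θ with
  | zero => simp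
  | add x y hx hy => simp only [map_add, hx, hy]
  | tmul b a => simp

theorem projRight_inclRight (Θ : B ⊗[k] CoordRing k n) :
    coeffMap B (projRight k n) (coeffMap B (inclRight k n) Θ) = Θ := by
  induction Θ with
  | zero => simp
  | add x y hx hy => simp only [map_add, hx, hy]
  | tmul b a => simp

theorem projLeft_inclRight (Θ : B ⊗[k] CoordRing k n) :
    coeffMap B (projLeft k n) (coeffMap B (inclRight k n) Θ) = evalOne k n B Θ ⊗ₜ[k] 1 := by
  induction Θ with
  | zero => simp
  | add x y hx hy => simp only [map_add, hx, hy, TensorProduct.add_tmul]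
  | tmul b a => simp [TensorProduct.smul_tmul]

theorem projRight_inclLeft (Θ : B ⊗[k] CoordRing k n) :
    coeffMap B (projRight k n) (coeffMap B (inclLeft k n) Θ) = evalOne k n B Θ ⊗ₜ[k] 1 := by
  induction Θ with
  | zero => simp
  | add x y hx hy => simp only [map_add, hx, hy, TensorProduct.add_tmul]
  | tmul b a => simp [TensorProduct.smul_tmul]

variable {Θ : B ⊗[k] CoordRing k n}

/-- This is `Θ(gh) = Θ(g) Θ(h)` differentiated in `h` along `X` at `h = 1`. -/
theorem lTensor_invDeriv (hΘ : IsRepElement Θ) (X : strictUpper k n) :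
    (invDeriv X.1 : CoordRing k n →ₗ[k] CoordRing k n).lTensor B Θ =
      Θ * differential Θ X ⊗ₜ[k] 1 := by
  set D := invDeriv X.1 with hD
  have h1 : (D : CoordRing k n →ₗ[k] CoordRing k n).lTensor B Θ = coeffMap B (projLeft k n)
      ((derivRight D : _ →ₗ[k] CoordRing k n ⊗[k] CoordRing k n).lTensor B
        (coeffMap B (comul k n) Θ)) := by
    rw [coeffMap_apply, coeffMap_apply, lTensor_lTensor, lTensor_lTensor]
    exact lTensor_congr (invDeriv_eq_projLeft X) Θ
  rw [h1, hΘ.comul_eq, lTensor_derivation_mul, lTensor_derivRight_inclLeft, zero_mul, zero_add,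
    lTensor_derivRight_inclRight, map_mul, projLeft_inclLeft, projLeft_inclRight]
  rfl

theorem lTensor_derivation_mul_tmul_one (D : Derivation k (CoordRing k n) (CoordRing k n))
    (x : B ⊗[k] CoordRing k n) (b : B) :
    (D : CoordRing k n →ₗ[k] CoordRing k n).lTensor B (x * b ⊗ₜ[k] 1) =
      (D : CoordRing k n →ₗ[k] CoordRing k n).lTensor B x * b ⊗ₜ[k] 1 := by
  rw [lTensor_derivation_mul]
  simp

theorem differential_eq_of_lTensor_eq (h1 : evalOne k n B Θ = 1) {X : strictUpper k n} {b : B}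
    (h : (invDeriv X.1 : CoordRing k n →ₗ[k] CoordRing k n).lTensor B Θ = Θ * b ⊗ₜ[k] 1) :
    differential Θ X = b := by
  rw [differential, h, map_mul, h1, one_mul]
  simp

/-- The differential of a representation, as a homomorphism of Lie algebras. -/
noncomputable def differentialHom (hΘ : IsRepElement Θ) : strictUpper k n →ₗ⁅k⁆ B where
  toFun := differential Θ
  map_add' X Y := by
    simp only [differential]
    rw [← map_add, ← LinearMap.add_apply, ← LinearMap.lTensor_add]
    refine congrArg _ (lTensor_congr (fun a => ?_) Θ)
    exact DFunLike.congr_fun (invDeriv_add X.1 Y.1) a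
  map_smul' c X := by
    simp only [differential]
    rw [RingHom.id_apply, ← map_smul, ← LinearMap.smul_apply, ← LinearMap.lTensor_smul]
    refine congrArg _ (lTensor_congr (fun a => ?_) Θ)
    exact DFunLike.congr_fun (invDeriv_smul c X.1) a
  map_lie' {X Y} := by
    refine differential_eq_of_lTensor_eq hΘ.evalOne_eq ?_
    have h2 : ∀ X Y : strictUpper k n, ((invDeriv X.1 : CoordRing k n →ₗ[k] CoordRing k n) ∘ₗ
        (invDeriv Y.1 : CoordRing k n →ₗ[k] CoordRing k n)).lTensor B Θ =
        Θ * (differential Θ X * differential Θ Y) ⊗ₜ[k] 1 := by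
      intro X Y
      rw [← lTensor_lTensor, lTensor_invDeriv hΘ Y, lTensor_derivation_mul_tmul_one,
        lTensor_invDeriv hΘ X, mul_assoc, Algebra.TensorProduct.tmul_mul_tmul, one_mul]
    have h3 := lTensor_congr (B := B) (f := (invDeriv (⁅X, Y⁆ : strictUpper k n).1 :
      CoordRing k n →ₗ[k] CoordRing k n)) (g := (invDeriv X.1 : CoordRing k n →ₗ[k] CoordRing k n)
        ∘ₗ (invDeriv Y.1 : CoordRing k n →ₗ[k] CoordRing k n) -
        (invDeriv Y.1 : CoordRing k n →ₗ[k] CoordRing k n) ∘ₗ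
          (invDeriv X.1 : CoordRing k n →ₗ[k] CoordRing k n)) (invDeriv_lie X Y) Θ
    rw [h3, LinearMap.lTensor_sub, LinearMap.sub_apply, h2, h2, ← mul_sub,
      ← TensorProduct.sub_tmul, Ring.lie_def]

variable {p : ℕ} [hp : Fact p.Prime] [CharP k p]

/-- Iterating the invariant derivation on `Θ` multiplies it on the right by powers of its
differential, and the `p`-th iterate is zero. This supplies the nilpotency that a decomposition
demands. -/
theorem differential_pow_char (hn : n ≤ p) (hΘ : IsRepElement Θ) (X : strictUpper k n) :
    differential Θ X ^ p = 0 := by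
  have h : ∀ m, ((invDeriv X.1 : Module.End k (CoordRing k n)) ^ m).lTensor B Θ =
      Θ * (differential Θ X ^ m) ⊗ₜ[k] 1 := by
    intro m
    induction m with
    | zero => simp [Module.End.one_eq_id, ← Algebra.TensorProduct.one_def]
    | succ m ih =>
      rw [pow_succ', Module.End.mul_eq_comp, ← lTensor_lTensor, ih,
        lTensor_derivation_mul_tmul_one, lTensor_invDeriv hΘ, mul_assoc,
        Algebra.TensorProduct.tmul_mul_tmul, one_mul, pow_succ']
  have h1 := congrArg (evalOne k n B) (h p)
  rw [invDeriv_pow_char hn, map_mul, hΘ.evalOne_eq, one_mul] at h1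
  simpa using h1.symm

/-- The Frobenius twist commutes with the Hopf structure, and it is injective on `B ⊗ A ⊗ A` by
flatness. The latter allows a representation to be untwisted. -/
theorem isRepElement_coeffMap_expand : IsRepElement (coeffMap B (expand p) Θ) ↔
    IsRepElement Θ := by
  let ee := Algebra.TensorProduct.map (expand p : CoordRing k n →ₐ[k] CoordRing k n)
    (expand p : CoordRing k n →ₐ[k] CoordRing k n)
  have hee : Function.Injective (coeffMap B ee) := by
    have h0 : Function.Injective (expand p : CoordRing k n →ₐ[k] CoordRing k n) :=
      expand_injective hp.out.pos
    exact lTensor_injective (f := ee.toLinearMap) (TensorProduct.map_injective_of_flat_flat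
      (expand p : CoordRing k n →ₐ[k] CoordRing k n).toLinearMap
      (expand p : CoordRing k n →ₐ[k] CoordRing k n).toLinearMap h0 h0)
  have h1 : coeffMap B (comul k n) (coeffMap B (expand p) Θ) =
      coeffMap B ee (coeffMap B (comul k n) Θ) := by
    rw [coeffMap_coeffMap, coeffMap_coeffMap]
    exact coeffMap_congr comul_expand Θ
  have h2 : coeffMap B (inclLeft k n) (coeffMap B (expand p) Θ) =
      coeffMap B ee (coeffMap B (inclLeft k n) Θ) := by
    rw [coeffMap_coeffMap, coeffMap_coeffMap]
    exact coeffMap_congr (fun a => by simp [ee]) Θ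
  have h3 : coeffMap B (inclRight k n) (coeffMap B (expand p) Θ) =
      coeffMap B ee (coeffMap B (inclRight k n) Θ) := by
    rw [coeffMap_coeffMap, coeffMap_coeffMap]
    exact coeffMap_congr (fun a => by simp [ee]) Θ
  have h4 : evalOne k n B (coeffMap B (expand p) Θ) = evalOne k n B Θ := by
    rw [evalOne, AlgHom.comp_apply, AlgHom.comp_apply, coeffMap_coeffMap]
    exact congrArg _ (coeffMap_congr counit_expand Θ)
  constructor
  · rintro ⟨h5, h6⟩
    rw [h1, h2, h3, ← map_mul] at h5
    exact ⟨hee h5, h4 ▸ h6⟩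
  · rintro ⟨h5, h6⟩
    refine ⟨?_, h4.trans h6⟩
    rw [h1, h2, h3, ← map_mul, h5]

variable {E : ℕ → Submodule k B} {d : ℕ} {φ : strictUpper k n →ₗ⁅k⁆ B}

theorem isRepElement_expRep (hE : IsNilFiltration E d) (hφ : IsAdapted E φ) (hd : d ≤ p)
    (hn : n ≤ p) : IsRepElement (expRep p φ (generic k n)) where
  comul_eq := by
    rw [coeffMap_expRep, coeffMap_expRep, coeffMap_expRep, generic_map_comul,
      expRep_mul hE hφ hd hn (generic_map_sub_one_mem _) (generic_map_sub_one_mem _)]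
  evalOne_eq := by
    rw [evalOne, AlgHom.comp_apply, coeffMap_expRep, generic_map_counit, expRep_one, map_one]

theorem lTensor_invDeriv_expRep (hE : IsNilFiltration E d) (hφ : IsAdapted E φ) (hd : d ≤ p)
    (hn : n ≤ p) (X : strictUpper k n) :
    (invDeriv X.1 : CoordRing k n →ₗ[k] CoordRing k n).lTensor B (expRep p φ (generic k n)) =
      expRep p φ (generic k n) * φ X ⊗ₜ[k] 1 := by
  rw [lTensor_derivation_expRep hE hφ hd hn (invDeriv X.1) generic_sub_one_mem
    (generic_map_invDeriv X), ← extend_map_smul φ X (1 : CoordRing k n)]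
  congr 2
  ext1 i j
  rw [Matrix.map_apply, Matrix.map_apply, Algebra.algebraMap_eq_smul_one]

theorem differential_expRep (hE : IsNilFiltration E d) (hφ : IsAdapted E φ) (hd : d ≤ p)
    (hn : n ≤ p) (X : strictUpper k n) : differential (expRep p φ (generic k n)) X = φ X :=
  differential_eq_of_lTensor_eq (isRepElement_expRep hE hφ hd hn).evalOne_eq
    (lTensor_invDeriv_expRep hE hφ hd hn X)

end RepElement

/-! ### Engel's theorem and the filtration of `End V` it produces. -/

section Engel

variable {k : Type*} [Field k] {n : ℕ} {V : Type*} [AddCommGroup V] [Module k V]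
  [FiniteDimensional k V]

/-- A Lie algebra acting by nilpotent operators lowers a flag of length at most `dim V`. -/
theorem exists_flag {L : Type*} [LieRing L] [LieAlgebra k L] (φ : L →ₗ⁅k⁆ Module.End k V)
    (hφ : ∀ X, IsNilpotent (φ X)) : ∃ F : ℕ → Submodule k V, Antitone F ∧ F 0 = ⊤ ∧
      F (Module.finrank k V) = ⊥ ∧ ∀ X i, ∀ v ∈ F i, φ X v ∈ F (i + 1) := by
  let _ : LieRingModule L V := LieRingModule.compLieHom V φ
  have _ : LieModule k L V := LieModule.compLieHom V φ
  have hnil : LieModule.IsNilpotent L V :=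
    (LieModule.isNilpotent_iff_forall' (R := k) (L := L) (M := V)).2 fun X => hφ X
  let F : ℕ → Submodule k V := fun i => (LieModule.lowerCentralSeries k L V i).toSubmodule
  have hanti : Antitone F := LieModule.antitone_lowerCentralSeries k L V
  obtain ⟨N, hN⟩ := LieModule.IsNilpotent.nilpotent k L V
  -- Once the lower central series repeats it is constant, but it reaches zero. Hence the dimension
  -- drops at every step before zero, and at most `dim V` steps occur.
  have hstab : ∀ i, F (i + 1) = F i → F i = ⊥ := by
    intro i hi
    have hi' : LieModule.lowerCentralSeries k L V (i + 1) = LieModule.lowerCentralSeries k L V i :=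
      LieSubmodule.toSubmodule_injective hi
    have h : ∀ j, LieModule.lowerCentralSeries k L V (i + j) =
        LieModule.lowerCentralSeries k L V i := by
      intro j
      induction j with
      | zero => rfl
      | succ j ih =>
        rw [← add_assoc, LieModule.lowerCentralSeries_succ, ih,
          ← LieModule.lowerCentralSeries_succ, hi']
    have h1 : F (i + N) = F i := congrArg (fun N : LieSubmodule k L V => N.toSubmodule) (h N)
    have h2 : F N = ⊥ := by
      change (LieModule.lowerCentralSeries k L V N).toSubmodule = ⊥
      rw [hN]
      rfl
    rw [← h1, eq_bot_iff, ← h2]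
    exact hanti (by omega)
  have hrank : ∀ i, F i = ⊥ ∨ Module.finrank k (F i) + i ≤ Module.finrank k V := by
    intro i
    induction i with
    | zero => exact Or.inr (by simpa using Submodule.finrank_le (F 0))
    | succ i ih =>
      by_cases h : F (i + 1) = F i
      · exact Or.inl (h.trans (hstab i h))
      · have hlt : F (i + 1) < F i := lt_of_le_of_ne (hanti (by omega)) h
        rcases ih with ih | ih
        · rw [ih] at hlt
          exact absurd hlt not_lt_bot
        · have := Submodule.finrank_lt_finrank_of_lt hlt
          exact Or.inr (by omega)
  refine ⟨F, hanti, rfl, ?_, fun X i v hv => ?_⟩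
  · rcases hrank (Module.finrank k V) with h | h
    · exact h
    · exact Submodule.finrank_eq_zero.1 (by omega)
  · change φ X v ∈ LieModule.lowerCentralSeries k L V (i + 1)
    rw [LieModule.lowerCentralSeries_succ]
    exact LieSubmodule.lie_mem_lie (LieSubmodule.mem_top X) hv

/-- `E i` consists of the operators that move the flag down by at least `i` steps. The matrix unit
`ε_{ij}` is an iterated bracket of `j - i` elements, each of which moves the flag down by one. -/
theorem exists_filtration (φ : strictUpper k n →ₗ⁅k⁆ Module.End k V)
    (hφ : ∀ X, IsNilpotent (φ X)) : ∃ E : ℕ → Submodule k (Module.End k V),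
      IsNilFiltration E (Module.finrank k V) ∧ IsAdapted E φ := by
  obtain ⟨F, hanti, h0, hbot, hF⟩ := exists_flag φ hφ
  let E : ℕ → Submodule k (Module.End k V) := fun i =>
    { carrier := {T | ∀ j, ∀ v ∈ F j, T v ∈ F (j + i)}
      zero_mem' := fun j v _ => zero_mem _
      add_mem' := fun hS hT j v hv => add_mem (hS j v hv) (hT j v hv)
      smul_mem' := fun c T hT j v hv => Submodule.smul_mem _ c (hT j v hv) }
  have hmul : ∀ {i j a b}, a ∈ E i → b ∈ E j → a * b ∈ E (i + j) := by
    intro i j a b ha hb l v hv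
    have := ha _ _ (hb l v hv)
    rwa [add_assoc, add_comm j i] at this
  refine ⟨E, ⟨fun j v hv => hv, hmul, fun i j hij T hT l v hv => hanti (by omega) (hT l v hv),
    fun i hi => ?_⟩, ?_⟩
  · rw [eq_bot_iff]
    intro T hT
    rw [Submodule.mem_bot]
    refine LinearMap.ext fun v => ?_
    have h1 := hT 0 v (h0 ▸ Submodule.mem_top)
    have h2 := hanti hi (by simpa using h1)
    rw [hbot, Submodule.mem_bot] at h2
    simpa using h2
  · have key : ∀ m (r : Pos n), (r.1.2 : ℕ) = r.1.1 + (m + 1) → φ (matrixUnit k r) ∈ E (m + 1) := by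
      intro m
      induction m with
      | zero => intro r _ j v hv; exact hF _ j v hv
      | succ m ih =>
        rintro ⟨⟨i, j⟩, hij⟩ hr
        simp only at hr
        let l : Fin n := ⟨i + 1, by omega⟩
        have hil : i < l := Fin.lt_def.2 (by simp [l])
        have hlj : l < j := Fin.lt_def.2 (by simp only [l]; omega)
        -- `ε_{ij} = [ε_{i,i+1}, ε_{i+1,j}]`: the reversed product vanishes since `i ≠ j`.
        have hbr : matrixUnit k ⟨(i, j), hij⟩ =
            ⁅matrixUnit k ⟨(i, l), hil⟩, matrixUnit k ⟨(l, j), hlj⟩⁆ := by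
          apply Subtype.ext
          rw [LieSubalgebra.coe_bracket, Ring.lie_def]
          simp [matrixUnit, Matrix.single_mul_single_of_ne, hij.ne']
        have h1 : φ (matrixUnit k ⟨(i, l), hil⟩) ∈ E 1 := fun j v hv => hF _ j v hv
        have h2 := ih ⟨(l, j), hlj⟩ (by simp only [l]; omega)
        rw [hbr, LieHom.map_lie, Ring.lie_def]
        have h3 := hmul h1 h2
        rw [add_comm 1] at h3
        exact sub_mem h3 (hmul h2 h1)
    intro r
    have hr := Fin.lt_def.1 r.2
    obtain ⟨m, hm⟩ : ∃ m, (r.1.2 : ℕ) - r.1.1 = m + 1 := ⟨r.1.2 - r.1.1 - 1, by omega⟩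
    rw [hm]
    exact key m r (by omega)

end Engel

/-! ### Coactions, matrix formulas and intertwiners. -/

section Coaction

variable {k : Type*} [Field k] {n : ℕ} {V W : Type*} [AddCommGroup V] [Module k V]
  [AddCommGroup W] [Module k W]

/-- The linear map `V → V ⊗ R` attached to an element of `End V ⊗ R`. -/
noncomputable def coact {R : Type*} [AddCommGroup R] [Module k R] (Θ : Module.End k V ⊗[k] R) :
    V →ₗ[k] V ⊗[k] R :=
  TensorProduct.rTensorHomToHomRTensor (RingHom.id k) V V R Θ

section

variable {R R' : Type*} [AddCommGroup R] [Module k R] [AddCommGroup R'] [Module k R']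

@[simp]
theorem coact_zero : coact (0 : Module.End k V ⊗[k] R) = 0 := map_zero _

@[simp]
theorem coact_add (x y : Module.End k V ⊗[k] R) : coact (x + y) = coact x + coact y :=
  map_add _ _ _

@[simp]
theorem coact_tmul (T : Module.End k V) (a : R) (v : V) : coact (T ⊗ₜ[k] a) v = T v ⊗ₜ[k] a := rfl

theorem lTensor_coact (h : R →ₗ[k] R') (Θ : Module.End k V ⊗[k] R) (v : V) :
    h.lTensor V (coact Θ v) = coact (h.lTensor (Module.End k V) Θ) v := by
  induction Θ with
  | zero => simp
  | add x y hx hy => simp [hx, hy]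
  | tmul T a => simp

theorem rTensor_lTensor_comm (f : V →ₗ[k] W) (h : R →ₗ[k] R') (x : V ⊗[k] R) :
    f.rTensor R' (h.lTensor V x) = h.lTensor W (f.rTensor R x) := by
  induction x with
  | zero => simp
  | add x y hx hy => simp [hx, hy]
  | tmul v a => simp

theorem coact_injective [FiniteDimensional k V] :
    Function.Injective (coact : Module.End k V ⊗[k] R → V →ₗ[k] V ⊗[k] R) := by
  intro x y h
  apply (rTensorHomEquivHomRTensor k V V R).injective
  rw [rTensorHomEquivHomRTensor_apply, rTensorHomEquivHomRTensor_apply]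
  exact h

theorem coact_surjective [FiniteDimensional k V] :
    Function.Surjective (coact : Module.End k V ⊗[k] R → V →ₗ[k] V ⊗[k] R) := by
  intro ρ
  obtain ⟨x, hx⟩ := (rTensorHomEquivHomRTensor k V V R).surjective ρ
  rw [rTensorHomEquivHomRTensor_apply] at hx
  exact ⟨x, hx⟩

/-- `f Θ = Ξ f`. -/
def Intertwines (f : V →ₗ[k] W) (Θ : Module.End k V ⊗[k] R) (Ξ : Module.End k W ⊗[k] R) : Prop :=
  ∀ v, f.rTensor R (coact Θ v) = coact Ξ (f v)

theorem intertwines_lTensor {f : V →ₗ[k] W} {Θ : Module.End k V ⊗[k] R}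
    {Ξ : Module.End k W ⊗[k] R} (h : R →ₗ[k] R') (hf : Intertwines f Θ Ξ) :
    Intertwines f (h.lTensor (Module.End k V) Θ) (h.lTensor (Module.End k W) Ξ) := by
  intro v
  rw [← lTensor_coact, ← lTensor_coact, ← hf v, rTensor_lTensor_comm]

theorem intertwines_of_lTensor {f : V →ₗ[k] W} {Θ : Module.End k V ⊗[k] R}
    {Ξ : Module.End k W ⊗[k] R} {h : R →ₗ[k] R'} (hh : Function.Injective h)
    (hf : Intertwines f (h.lTensor (Module.End k V) Θ) (h.lTensor (Module.End k W) Ξ)) :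
    Intertwines f Θ Ξ := by
  intro v
  apply Module.Flat.lTensor_preserves_injective_linearMap (M := W) h hh
  have := hf v
  rw [← lTensor_coact, ← lTensor_coact] at this
  rw [← this, rTensor_lTensor_comm]

end

theorem isMorphism_iff_intertwines {f : V →ₗ[k] W} {Θ : Module.End k V ⊗[k] CoordRing k n}
    {Ξ : Module.End k W ⊗[k] CoordRing k n} :
    IsMorphism f (toCoaction Θ) (toCoaction Ξ) ↔ Intertwines f Θ Ξ :=
  LinearMap.ext_iff

variable {R : Type*} [CommRing R] [Algebra k R]

/-- The action of `End V ⊗ R` on `V ⊗ R`. -/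
noncomputable def opHom (k V R : Type*) [Field k] [AddCommGroup V] [Module k V] [CommRing R]
    [Algebra k R] : Module.End k V ⊗[k] R →ₐ[k] Module.End k (V ⊗[k] R) :=
  (Module.endTensorEndAlgHom (R := k) (S := k) (A := k) (M := V) (N := R)).comp
    (Algebra.TensorProduct.map (AlgHom.id k _) (Algebra.lmul k R))

theorem opHom_tmul (T : Module.End k V) (a : R) (v : V) (b : R) :
    opHom k V R (T ⊗ₜ[k] a) (v ⊗ₜ[k] b) = T v ⊗ₜ[k] (a * b) := rfl

theorem opHom_apply (Θ : Module.End k V ⊗[k] R) (v : V) (b : R) :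
    opHom k V R Θ (v ⊗ₜ[k] b) = (LinearMap.mulRight k b).lTensor V (coact Θ v) := by
  induction Θ with
  | zero => simp
  | add x y hx hy => simp [hx, hy]
  | tmul T a => simp [opHom_tmul]

theorem intertwines_iff {f : V →ₗ[k] W} {Θ : Module.End k V ⊗[k] R} {Ξ : Module.End k W ⊗[k] R} :
    Intertwines f Θ Ξ ↔ f.rTensor R ∘ₗ opHom k V R Θ = opHom k W R Ξ ∘ₗ f.rTensor R := by
  constructor
  · intro h
    refine TensorProduct.ext' fun v b => ?_
    rw [LinearMap.comp_apply, LinearMap.comp_apply, LinearMap.rTensor_tmul, opHom_apply,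
      opHom_apply, ← h v, rTensor_lTensor_comm]
  · intro h v
    have h1 := LinearMap.congr_fun h (v ⊗ₜ 1)
    simpa [opHom_apply] using h1

/-- The pairs `(Θ, Ξ)` with `f Θ = Ξ f`. -/
noncomputable def intertwinedPairs (f : V →ₗ[k] W) (R : Type*) [CommRing R] [Algebra k R] :
    Subalgebra k ((Module.End k V ⊗[k] R) × (Module.End k W ⊗[k] R)) where
  carrier := {x | f.rTensor R ∘ₗ opHom k V R x.1 = opHom k W R x.2 ∘ₗ f.rTensor R}
  mul_mem' := by
    intro x y hx hy
    simp only [Set.mem_ofPred_eq, Prod.fst_mul, Prod.snd_mul, map_mul, Module.End.mul_eq_comp] at *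
    rw [← LinearMap.comp_assoc, hx, LinearMap.comp_assoc, hy, LinearMap.comp_assoc]
  add_mem' := by
    intro x y hx hy
    simp only [Set.mem_ofPred_eq, Prod.fst_add, Prod.snd_add, map_add, LinearMap.comp_add,
      LinearMap.add_comp] at *
    rw [hx, hy]
  algebraMap_mem' := by
    intro c
    simp only [Set.mem_ofPred_eq, Prod.algebraMap_apply, AlgHom.commutes]
    refine LinearMap.ext fun x => ?_
    simp

theorem mem_intertwinedPairs {f : V →ₗ[k] W} {Θ : Module.End k V ⊗[k] R}
    {Ξ : Module.End k W ⊗[k] R} : (Θ, Ξ) ∈ intertwinedPairs f R ↔ Intertwines f Θ Ξ :=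
  intertwines_iff.symm

theorem intertwines_mul {f : V →ₗ[k] W} {Θ Θ' : Module.End k V ⊗[k] R}
    {Ξ Ξ' : Module.End k W ⊗[k] R} (h : Intertwines f Θ Ξ) (h' : Intertwines f Θ' Ξ') :
    Intertwines f (Θ * Θ') (Ξ * Ξ') :=
  mem_intertwinedPairs.1 (mul_mem (mem_intertwinedPairs.2 h) (mem_intertwinedPairs.2 h'))

theorem intertwines_one (f : V →ₗ[k] W) :
    Intertwines f (1 : Module.End k V ⊗[k] R) (1 : Module.End k W ⊗[k] R) :=
  mem_intertwinedPairs.1 (one_mem _)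

/-- From `f Θ Θ' = Ξ Ξ' f` and `f Θ = Ξ f` follows `Ξ f Θ' = Ξ Ξ' f`, so only a left inverse of `Ξ`
is needed. -/
theorem intertwines_cancel {f : V →ₗ[k] W} {Θ Θ' : Module.End k V ⊗[k] R}
    {Ξ Ξ' Ξi : Module.End k W ⊗[k] R} (hi : Ξi * Ξ = 1) (h : Intertwines f Θ Ξ)
    (h' : Intertwines f (Θ * Θ') (Ξ * Ξ')) : Intertwines f Θ' Ξ' := by
  rw [intertwines_iff] at *
  rw [map_mul, map_mul, Module.End.mul_eq_comp, Module.End.mul_eq_comp, ← LinearMap.comp_assoc, h,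
    LinearMap.comp_assoc, LinearMap.comp_assoc] at h'
  have h1 : opHom k W R Ξi ∘ₗ opHom k W R Ξ = LinearMap.id := by
    rw [← Module.End.mul_eq_comp, ← map_mul, hi, map_one]
    rfl
  have h2 := congrArg (fun T => opHom k W R Ξi ∘ₗ T) h'
  simpa only [← LinearMap.comp_assoc, h1, LinearMap.id_comp] using h2

theorem intertwines_of_commute {f : Module.End k V} {Θ : Module.End k V ⊗[k] R}
    (h : Commute (f ⊗ₜ[k] (1 : R)) Θ) : Intertwines f Θ Θ := by
  have h1 : opHom k V R (f ⊗ₜ[k] (1 : R)) = f.rTensor R := by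
    refine TensorProduct.ext' fun v b => ?_
    simp [opHom_tmul]
  rw [intertwines_iff, ← h1, ← Module.End.mul_eq_comp, ← Module.End.mul_eq_comp, ← map_mul,
    ← map_mul, h.eq]

/-- Intertwined pairs form a subalgebra of the product algebra. It contains the pair of logarithms,
hence also their images under the exponential polynomial. -/
theorem intertwines_expRep {p : ℕ} {f : V →ₗ[k] W} {φ : strictUpper k n →ₗ⁅k⁆ Module.End k V}
    {ψ : strictUpper k n →ₗ⁅k⁆ Module.End k W} (h : ∀ X, f ∘ₗ φ X = ψ X ∘ₗ f)
    (g : Matrix (Fin n) (Fin n) R) : Intertwines f (expRep p φ g) (expRep p ψ g) := by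
  have h1 : (extend φ R (logMatrix k p g), extend ψ R (logMatrix k p g)) ∈
      intertwinedPairs f R := by
    have h0 : (extend φ R (logMatrix k p g), extend ψ R (logMatrix k p g)) =
        ∑ r : Pos n, (φ (matrixUnit k r) ⊗ₜ[k] logMatrix k p g r.1.1 r.1.2,
          ψ (matrixUnit k r) ⊗ₜ[k] logMatrix k p g r.1.1 r.1.2) :=
      Prod.ext (by rw [Prod.fst_sum]; exact extend_apply ..)
        (by rw [Prod.snd_sum]; exact extend_apply ..)
    rw [h0]
    refine sum_mem fun r _ => mem_intertwinedPairs.2 fun v => ?_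
    have := LinearMap.congr_fun (h (matrixUnit k r)) v
    simp only [LinearMap.comp_apply] at this
    simp [this]
  have h2 := aeval_mem_subalgebra h1 (expPoly k p)
  have h3 := Polynomial.aeval_algHom_apply (AlgHom.fst k (Module.End k V ⊗[k] R)
    (Module.End k W ⊗[k] R)) (extend φ R (logMatrix k p g), extend ψ R (logMatrix k p g))
    (expPoly k p)
  have h4 := Polynomial.aeval_algHom_apply (AlgHom.snd k (Module.End k V ⊗[k] R)
    (Module.End k W ⊗[k] R)) (extend φ R (logMatrix k p g), extend ψ R (logMatrix k p g))
    (expPoly k p)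
  refine mem_intertwinedPairs.1 ?_
  convert h2 using 1
  exact Prod.ext h3 h4

theorem rid_counit_coact (Θ : Module.End k V ⊗[k] CoordRing k n) (v : V) :
    TensorProduct.rid k V ((counit k n).toLinearMap.lTensor V (coact Θ v)) =
      evalOne k n (Module.End k V) Θ v := by
  induction Θ with
  | zero => simp
  | add x y hx hy => simp only [coact_add, LinearMap.add_apply, map_add, hx, hy]
  | tmul T a => simp

theorem comp_evalOne {f : V →ₗ[k] W} {Θ : Module.End k V ⊗[k] CoordRing k n}
    {Ξ : Module.End k W ⊗[k] CoordRing k n} (h : Intertwines f Θ Ξ) :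
    f ∘ₗ evalOne k n (Module.End k V) Θ = evalOne k n (Module.End k W) Ξ ∘ₗ f := by
  refine LinearMap.ext fun v => ?_
  have h1 : ∀ y : V ⊗[k] k, f (TensorProduct.rid k V y) =
      TensorProduct.rid k W (f.rTensor k y) := by
    intro y
    induction y with
    | zero => simp
    | add x y hx hy => simp only [map_add, hx, hy]
    | tmul v c => simp
  rw [LinearMap.comp_apply, LinearMap.comp_apply, ← rid_counit_coact, ← rid_counit_coact, h1,
    rTensor_lTensor_comm, h v]

theorem comp_differential {f : V →ₗ[k] W} {Θ : Module.End k V ⊗[k] CoordRing k n}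
    {Ξ : Module.End k W ⊗[k] CoordRing k n} (h : Intertwines f Θ Ξ) (X : strictUpper k n) :
    f ∘ₗ differential Θ X = differential Ξ X ∘ₗ f :=
  comp_evalOne (intertwines_lTensor _ h)

theorem isRepresentation_iff [FiniteDimensional k V] {Θ : Module.End k V ⊗[k] CoordRing k n} :
    IsRepresentation (toCoaction Θ) ↔ IsRepElement Θ := by
  -- Iterated coaction corresponds to the product `Θ(g) Θ'(h)`. Two independent elements make the
  -- identity bilinear, so it can be checked on pure tensors.
  have h1 : ∀ (Θ Θ' : Module.End k V ⊗[k] CoordRing k n) (v : V),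
      TensorProduct.assoc k V (CoordRing k n) (CoordRing k n)
        ((coact Θ).rTensor (CoordRing k n) (coact Θ' v)) =
      coact (coeffMap (Module.End k V) (inclLeft k n) Θ *
        coeffMap (Module.End k V) (inclRight k n) Θ') v := by
    intro Θ Θ' v
    induction Θ' with
    | zero => simp
    | add x y hx hy => simp only [coact_add, LinearMap.add_apply, map_add, mul_add, hx, hy]
    | tmul T' a' =>
      induction Θ with
      | zero => simp
      | add x y hx hy =>
        simp only [coact_add, LinearMap.rTensor_add, LinearMap.add_apply, map_add, add_mul, hx, hy]
      | tmul T a => simp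
  constructor
  · rintro ⟨h3, h4⟩
    refine ⟨coact_injective (LinearMap.ext fun v => ?_), LinearMap.ext fun v => ?_⟩
    · have := LinearMap.congr_fun h3 v
      rw [← h1, coeffMap_apply, ← lTensor_coact]
      exact this.symm
    · rw [← rid_counit_coact]
      exact LinearMap.congr_fun h4 v
  · rintro ⟨h3, h4⟩
    refine ⟨LinearMap.ext fun v => ?_, LinearMap.ext fun v => ?_⟩
    · refine (h1 Θ Θ v).trans ?_
      rw [← h3, coeffMap_apply, ← lTensor_coact]
      rfl
    · refine (rid_counit_coact Θ v).trans ?_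
      rw [h4]
      rfl

end Coaction

/-! ### Functions killed by all invariant derivations are polynomials in `p`-th powers. -/

section Frobenius

open MvPolynomial

variable {k : Type*} [Field k] {n : ℕ} {B : Type*} [Ring B] [Algebra k B] {p : ℕ}
  [hp : Fact p.Prime] [CharP k p]

theorem derivation_expand (D : Derivation k (CoordRing k n) (CoordRing k n)) (a : CoordRing k n) :
    D (expand p a) = 0 := by
  induction a using MvPolynomial.induction_on with
  | C c => simp
  | add f g hf hg => rw [map_add, map_add, hf, hg, add_zero]
  | mul_X f r hf =>
    have h0 : ((p : ℕ) : CoordRing k n) = 0 := by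
      rw [← map_natCast (algebraMap k (CoordRing k n)), CharP.cast_eq_zero, map_zero]
    rw [map_mul, expand_X, Derivation.leibniz, hf, Derivation.leibniz_pow, ← Nat.cast_smul_eq_nsmul
      (CoordRing k n), h0]
    simp

theorem lTensor_derivation_coeffMap_expand (D : Derivation k (CoordRing k n) (CoordRing k n))
    (x : B ⊗[k] CoordRing k n) :
    (D : CoordRing k n →ₗ[k] CoordRing k n).lTensor B (coeffMap B (expand p) x) = 0 := by
  rw [coeffMap_apply, lTensor_lTensor]
  refine (lTensor_congr (g := 0) (derivation_expand D) x).trans ?_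
  rw [LinearMap.lTensor_zero, LinearMap.zero_apply]

theorem evalOne_coeffMap_expand (x : B ⊗[k] CoordRing k n) :
    evalOne k n B (coeffMap B (expand p) x) = evalOne k n B x := by
  rw [evalOne, AlgHom.comp_apply, AlgHom.comp_apply, coeffMap_coeffMap]
  exact congrArg _ (coeffMap_congr counit_expand x)

theorem derivation_sum_apply {R ι : Type*} [CommRing R] [Algebra k R] (s : Finset ι)
    (D : ι → Derivation k R R) (a : R) : (∑ i ∈ s, D i) a = ∑ i ∈ s, D i a := by
  have := congrFun (map_sum (Derivation.coeFnAddMonoidHom (R := k) (A := R) (M := R)) D s) a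
  rw [Finset.sum_apply] at this
  exact this

/-- The invariant derivations generate all derivations over `A_n`: the partial derivative in
direction `r` is their combination with the entries of `M = g⁻¹ ε_r` as coefficients. -/
theorem pderiv_eq_zero_of_invDeriv_eq_zero {f : CoordRing k n}
    (hf : ∀ X : strictUpper k n, invDeriv X.1 f = 0) (r : Pos n) : pderiv r f = 0 := by
  obtain ⟨g', hg0, hg', -⟩ := exists_inverse (generic_sub_one_mem (k := k) (n := n))
  set M := g' * Matrix.single r.1.1 r.1.2 1 with hMdef
  have hM : M ∈ band n _ 1 := by
    have := mul_mem_band hg0 (single_mem_band r (1 : CoordRing k n))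
    rwa [zero_add] at this
  have hgM : generic k n * M = Matrix.single r.1.1 r.1.2 1 := by
    rw [hMdef, ← mul_assoc, hg', one_mul]
  have h : pderiv r = ∑ s : Pos n, M s.1.1 s.1.2 • invDeriv (matrixUnit k s).1 := by
    refine derivation_ext fun t => ?_
    have h1 : generic k n * M = ∑ s : Pos n, M s.1.1 s.1.2 •
        (generic k n * (matrixUnit k s).1.map (algebraMap k (CoordRing k n))) := by
      conv_lhs => rw [eq_sum_single hM, Finset.mul_sum]
      refine Finset.sum_congr rfl fun s _ => ?_
      rw [← mul_smul_comm]
      congr 1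
      ext1 i j
      simp only [matrixUnit, Matrix.smul_apply, Matrix.map_apply, Matrix.single_apply]
      split_ifs <;> simp
    have h2 := congrFun (congrFun (h1.symm.trans hgM) t.1.1) t.1.2
    rw [Matrix.sum_apply] at h2
    have h3 : (∑ s : Pos n, M s.1.1 s.1.2 • invDeriv (matrixUnit k s).1) (MvPolynomial.X t) =
        ∑ s : Pos n, (M s.1.1 s.1.2 • (generic k n *
          (matrixUnit k s).1.map (algebraMap k (CoordRing k n)))) t.1.1 t.1.2 := by
      rw [derivation_sum_apply]
      refine Finset.sum_congr rfl fun s _ => ?_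
      rw [Derivation.smul_apply, invDeriv, mkDerivation_X, Matrix.smul_apply]
    rw [h3, h2]
    classical
    rw [pderiv_X, Matrix.single_apply, Pi.single_apply]
    congr 1
    rw [eq_iff_iff, Subtype.ext_iff, Prod.ext_iff]
    exact ⟨fun h => ⟨h.1.symm, h.2.symm⟩, fun h => ⟨h.1.symm, h.2.symm⟩⟩
  rw [h, derivation_sum_apply]
  refine Finset.sum_eq_zero fun s _ => ?_
  rw [Derivation.smul_apply, hf, smul_zero]

theorem eq_coeffMap_expand {x : B ⊗[k] CoordRing k n}
    (hx : ∀ X : strictUpper k n,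
      (invDeriv X.1 : CoordRing k n →ₗ[k] CoordRing k n).lTensor B x = 0) :
    x = coeffMap B (expand p) ((contract k p (Pos n)).lTensor B x) := by
  refine eq_of_slice_eq fun l => ?_
  rw [coeffMap_apply, slice_lTensor, slice_lTensor]
  refine (expand_contract fun m hm => dvd_of_pderiv_eq_zero (k := k) ?_ hm).symm
  refine pderiv_eq_zero_of_invDeriv_eq_zero fun X => ?_
  have := congrArg (slice l) (hx X)
  rwa [slice_lTensor, map_zero] at this

theorem lTensor_contract_mem_degLE {D : ℕ} {x : B ⊗[k] CoordRing k n}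
    (hx : x ∈ degLE k B (Pos n) k D) :
    (contract k p (Pos n)).lTensor B x ∈ degLE k B (Pos n) k (D / p) := by
  have h : degLE k B (Pos n) k D ≤
      (degLE k B (Pos n) k (D / p)).comap ((contract k p (Pos n)).lTensor B) := by
    rw [degLE, Submodule.span_le]
    rintro _ ⟨b, f, hf, rfl⟩
    exact Submodule.subset_span ⟨b, contract k p (Pos n) f,
      (totalDegree_contract_le f).trans (Nat.div_le_div_right hf), rfl⟩
  exact h hx

theorem eq_tmul_one_of_mem_degLE_zero {x : B ⊗[k] CoordRing k n}
    (hx : x ∈ degLE k B (Pos n) k 0) : x = evalOne k n B x ⊗ₜ[k] 1 := by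
  induction hx using Submodule.span_induction with
  | mem x hx =>
    obtain ⟨b, f, hf, rfl⟩ := hx
    rw [totalDegree_eq_zero_iff_eq_C.1 (Nat.le_zero.1 hf), evalOne_tmul, TensorProduct.smul_tmul,
      ← algebraMap_eq, AlgHom.commutes, Algebra.algebraMap_eq_smul_one]
    rfl
  | zero => simp
  | add x y _ _ hx hy =>
    conv_lhs => rw [hx, hy]
    rw [map_add, TensorProduct.add_tmul]
  | smul c x _ hx =>
    conv_lhs => rw [hx]
    rw [map_smul, TensorProduct.smul_tmul']

theorem commute_one_tmul {R : Type*} [CommRing R] [Algebra k R] (a : R) (x : B ⊗[k] R) :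
    Commute ((1 : B) ⊗ₜ[k] a) x := by
  induction x with
  | zero => exact Commute.zero_right _
  | tmul b c => simp [Commute, SemiconjBy, mul_comm a c]
  | add y z hy hz => exact hy.add_right hz

theorem commute_expRep {R : Type*} [CommRing R] [Algebra k R]
    {φ : strictUpper k n →ₗ⁅k⁆ B} {x : B ⊗[k] R} (hx : ∀ X, Commute (φ X ⊗ₜ[k] (1 : R)) x)
    (g : Matrix (Fin n) (Fin n) R) : Commute (expRep p φ g) x := by
  have h1 : extend φ R (logMatrix k p g) ∈ Subalgebra.centralizer k {x} := by
    rw [extend_apply]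
    refine sum_mem fun r _ => ?_
    rw [Subalgebra.mem_centralizer_iff]
    rintro _ rfl
    have h3 : ∀ (b : B) (a : R), b ⊗ₜ[k] a = b ⊗ₜ[k] 1 * (1 : B) ⊗ₜ[k] a := by
      intro b a
      simp
    rw [h3]
    exact ((hx _).mul_left (commute_one_tmul _ _)).eq.symm
  have h4 := aeval_mem_subalgebra h1 (expPoly k p)
  rw [Subalgebra.mem_centralizer_iff] at h4
  exact (h4 x rfl).symm

end Frobenius

/-! ### Existence of decompositions and their compatibility with morphisms. -/

section Decomposition

open MvPolynomial

variable {k : Type*} [Field k] {n : ℕ} {p : ℕ} [hp : Fact p.Prime] [CharP k p]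
  {V W : Type*} [AddCommGroup V] [Module k V] [FiniteDimensional k V]
  [AddCommGroup W] [Module k W] [FiniteDimensional k W]

/-- The product of the `(e^{φ_i(log g)})^{[p^i]}`. -/
noncomputable def expProd (p : ℕ) {l : ℕ}
    (φ : Fin l → (strictUpper k n →ₗ⁅k⁆ Module.End k V)) : Module.End k V ⊗[k] CoordRing k n :=
  (List.ofFn fun i : Fin l => coeffMap (Module.End k V) (expand (p ^ (i : ℕ)))
    (expRep p (φ i) (generic k n))).prod

theorem expProd_succ {l : ℕ} (φ : Fin (l + 1) → (strictUpper k n →ₗ⁅k⁆ Module.End k V)) :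
    expProd p φ = expRep p (φ 0) (generic k n) *
      coeffMap (Module.End k V) (expand p) (expProd p fun i => φ i.succ) := by
  rw [expProd, expProd, List.ofFn_succ, List.prod_cons, map_list_prod, List.map_ofFn]
  congr 1
  · rw [Fin.val_zero, pow_zero, expand_one]
    exact DFunLike.congr_fun (Algebra.TensorProduct.map_id) _
  · congr 2
    funext i
    rw [Function.comp_apply, coeffMap_coeffMap, Fin.val_succ, pow_succ', ← expand_mul_eq_comp]

theorem logGeneric_eq (hn : n ≤ p) : logGeneric k n = logMatrix k p (generic k n) := by
  have h : logMatrix k p (generic k n) = ∑ j ∈ Finset.Icc 1 (p - 1),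
      ((-1 : k) ^ (j - 1) * (j : k)⁻¹) • (generic k n - 1) ^ j := by
    rw [logMatrix, logPoly, map_sum]
    refine Finset.sum_congr rfl fun j _ => ?_
    rw [map_mul, Polynomial.aeval_C, map_pow, Polynomial.aeval_X, ← Algebra.smul_def]
  rw [h, logGeneric]
  refine Finset.sum_subset (Finset.Icc_subset_Icc_right (by omega)) fun j hj hj' => ?_
  rw [Finset.mem_Icc] at hj hj'
  rw [eq_zero_of_mem_band (by omega) (pow_mem_band generic_sub_one_mem j), smul_zero]

theorem factor_eq (hn : n ≤ p) (hd : Module.finrank k V ≤ p) {m : ℕ}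
    {φ : Fin (m + 1) → (strictUpper k n →ₗ⁅k⁆ Module.End k V)} (i : Fin (m + 1))
    (hφ : ∀ X, IsNilpotent (φ i X)) : factor p φ i =
      coeffMap (Module.End k V) (expand (p ^ (i : ℕ))) (expRep p (φ i) (generic k n)) := by
  obtain ⟨E, hE, hEφ⟩ := exists_filtration (φ i) hφ
  have h1 : atLog (φ i) = extend (φ i) _ (logMatrix k p (generic k n)) := by
    rw [atLog, logGeneric_eq hn, extend_apply]
  rw [factor, h1, nilExp_eq_aeval (extend_pow_eq_zero hE hEφ hd _)]
  rfl

theorem prod_factor_eq (hn : n ≤ p) (hd : Module.finrank k V ≤ p) {m : ℕ}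
    {φ : Fin (m + 1) → (strictUpper k n →ₗ⁅k⁆ Module.End k V)}
    (hφ : ∀ i X, IsNilpotent (φ i X)) :
    (List.ofFn fun i => factor p φ i).prod = expProd p φ := by
  rw [expProd]
  congr 2
  funext i
  exact factor_eq hn hd i (hφ i)

theorem isRepElement_coeffMap_expand_pow {B : Type*} [Ring B] [Algebra k B]
    {Θ : B ⊗[k] CoordRing k n} (hΘ : IsRepElement Θ) (i : ℕ) :
    IsRepElement (coeffMap B (expand (p ^ i)) Θ) := by
  induction i with
  | zero =>
    rw [pow_zero, expand_one]
    have : coeffMap B (AlgHom.id k (CoordRing k n)) Θ = Θ :=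
      DFunLike.congr_fun (Algebra.TensorProduct.map_id) _
    exact this.symm ▸ hΘ
  | succ i ih =>
    rw [pow_succ', expand_mul_eq_comp, ← coeffMap_coeffMap]
    exact isRepElement_coeffMap_expand.2 ih

theorem isRepElement_factor (hn : n ≤ p) (hd : Module.finrank k V ≤ p) {m : ℕ}
    {φ : Fin (m + 1) → (strictUpper k n →ₗ⁅k⁆ Module.End k V)} (i : Fin (m + 1))
    (hφ : ∀ X, IsNilpotent (φ i X)) : IsRepElement (factor p φ i) := by
  rw [factor_eq hn hd i hφ]
  obtain ⟨E, hE, hEφ⟩ := exists_filtration (φ i) hφ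
  exact isRepElement_coeffMap_expand_pow (isRepElement_expRep hE hEφ hd hn) i

theorem evalOne_expProd {l : ℕ} (φ : Fin l → (strictUpper k n →ₗ⁅k⁆ Module.End k V)) :
    evalOne k n _ (expProd p φ) = 1 := by
  induction l with
  | zero => simp [expProd]
  | succ l ih =>
    have h1 : evalOne k n (Module.End k V) (expRep p (φ 0) (generic k n)) = 1 := by
      rw [evalOne, AlgHom.comp_apply, coeffMap_expRep, generic_map_counit, expRep_one, map_one]
    rw [expProd_succ, map_mul, evalOne_coeffMap_expand, ih, h1, one_mul]

/-- All factors after the first involve only `p`-th powers of the variables, so derivations kill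
them, and their value at the identity is `1`. -/
theorem differential_expProd (hn : n ≤ p) (hd : Module.finrank k V ≤ p) {l : ℕ}
    {φ : Fin (l + 1) → (strictUpper k n →ₗ⁅k⁆ Module.End k V)}
    (hφ : ∀ i X, IsNilpotent (φ i X)) (X : strictUpper k n) :
    differential (expProd p φ) X = φ 0 X := by
  obtain ⟨E, hE, hEφ⟩ := exists_filtration (φ 0) (hφ 0)
  rw [differential, expProd_succ, lTensor_derivation_mul, lTensor_derivation_coeffMap_expand,
    mul_zero, add_zero, map_mul, evalOne_coeffMap_expand, evalOne_expProd, mul_one]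
  exact differential_expRep hE hEφ hd hn X

/-- Taking differentials gives the relation for index `0`; then the first factors are intertwined
and can be cancelled, and injectivity of the Frobenius twist passes to the remaining product. It
serves both the morphism criterion and the mutual commutation of the `φ_i`. -/
theorem comp_eq_of_intertwines_expProd (hn : n ≤ p) (hV : Module.finrank k V ≤ p)
    (hW : Module.finrank k W ≤ p) {f : V →ₗ[k] W} {l : ℕ}
    {φ : Fin l → (strictUpper k n →ₗ⁅k⁆ Module.End k V)}
    {ψ : Fin l → (strictUpper k n →ₗ⁅k⁆ Module.End k W)}
    (hφ : ∀ i X, IsNilpotent (φ i X)) (hψ : ∀ i X, IsNilpotent (ψ i X))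
    (h : Intertwines f (expProd p φ) (expProd p ψ)) (i : Fin l) (X : strictUpper k n) :
    f ∘ₗ φ i X = ψ i X ∘ₗ f := by
  induction l with
  | zero => exact i.elim0
  | succ l ih =>
    have h0 : ∀ X, f ∘ₗ φ 0 X = ψ 0 X ∘ₗ f := by
      intro X
      have := comp_differential h X
      rwa [differential_expProd hn hV hφ, differential_expProd hn hW hψ] at this
    obtain ⟨E, hE, hEψ⟩ := exists_filtration (ψ 0) (hψ 0)
    rw [expProd_succ, expProd_succ] at h
    have h1 := intertwines_cancel (expRepInv_mul_expRep hE hEψ hW (generic k n))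
      (intertwines_expRep h0 (generic k n)) h
    have h2 := intertwines_of_lTensor (h := (expand p : CoordRing k n →ₐ[k] _).toLinearMap)
      (expand_injective hp.out.pos) h1
    refine Fin.cases (h0 X) (fun j => ?_) i
    exact ih (fun i => hφ i.succ) (fun i => hψ i.succ) h2 j

theorem intertwines_factor (hn : n ≤ p) (hV : Module.finrank k V ≤ p)
    (hW : Module.finrank k W ≤ p) {f : V →ₗ[k] W} {m : ℕ}
    {φ : Fin (m + 1) → (strictUpper k n →ₗ⁅k⁆ Module.End k V)}
    {ψ : Fin (m + 1) → (strictUpper k n →ₗ⁅k⁆ Module.End k W)}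
    (hφ : ∀ i X, IsNilpotent (φ i X)) (hψ : ∀ i X, IsNilpotent (ψ i X)) (i : Fin (m + 1))
    (h : ∀ X, f ∘ₗ φ i X = ψ i X ∘ₗ f) : Intertwines f (factor p φ i) (factor p ψ i) := by
  rw [factor_eq hn hV i (hφ i), factor_eq hn hW i (hψ i)]
  exact intertwines_lTensor _ (intertwines_expRep h _)

theorem intertwines_prod {f : V →ₗ[k] W} {l : ℕ} {Θ : Fin l → Module.End k V ⊗[k] CoordRing k n}
    {Ξ : Fin l → Module.End k W ⊗[k] CoordRing k n} (h : ∀ i, Intertwines f (Θ i) (Ξ i)) :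
    Intertwines f (List.ofFn Θ).prod (List.ofFn Ξ).prod := by
  induction l with
  | zero => simpa using intertwines_one f
  | succ l ih =>
    rw [List.ofFn_succ, List.ofFn_succ, List.prod_cons, List.prod_cons]
    exact intertwines_mul (h 0) (ih fun i => h i.succ)

/-- Division of a representation by the exponential of its differential. -/
theorem exists_frobenius_quotient (hn : n ≤ p) (hd : 2 * Module.finrank k V ≤ p)
    {Φ : Module.End k V ⊗[k] CoordRing k n} (hΦ : IsRepElement Φ) {D : ℕ}
    (hD : Φ ∈ degLE k (Module.End k V) (Pos n) k (D + 1)) :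
    ∃ Ψ ∈ degLE k (Module.End k V) (Pos n) k D, IsRepElement Ψ ∧
      Φ = expRep p (differentialHom hΦ) (generic k n) *
        coeffMap (Module.End k V) (expand p) Ψ ∧
      ∀ X, Intertwines (differentialHom hΦ X) Ψ Ψ := by
  have hp2 := hp.out.two_le
  set φ := differentialHom hΦ with hφdef
  have hnil : ∀ X, IsNilpotent (φ X) := fun X => ⟨p, differential_pow_char hn hΦ X⟩
  obtain ⟨E, hE, hEφ⟩ := exists_filtration φ hnil
  have hd' : Module.finrank k V ≤ p := by omega
  set B := Module.End k V
  set Θ := expRep p φ (generic k n) with hΘdef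
  set Θ' := expRepInv p φ (generic k n) with hΘ'def
  have hΘΘ' : Θ * Θ' = 1 := expRep_mul_expRepInv hE hEφ hd' _
  have hΘ'Θ : Θ' * Θ = 1 := expRepInv_mul_expRep hE hEφ hd' _
  have hΘ : IsRepElement Θ := isRepElement_expRep hE hEφ hd' hn
  -- `Φ` and `Θ` both satisfy `D_X y = y φ(X)`, so invariant derivations kill their quotient `P`.
  set P := Φ * Θ' with hP
  have hPΘ : P * Θ = Φ := by rw [hP, mul_assoc, hΘ'Θ, mul_one]
  have hDP : ∀ X : strictUpper k n,
      (invDeriv X.1 : CoordRing k n →ₗ[k] CoordRing k n).lTensor B P = 0 := fun X =>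
    derivation_mul_inverse_eq_zero (lTensor_derivation_mul _) hΘΘ' hΘ'Θ
      (lTensor_invDeriv hΦ X) (lTensor_invDeriv_expRep hE hEφ hd' hn X)
  set Ψ := (contract k p (Pos n)).lTensor B P with hΨdef
  have hPΨ : P = coeffMap B (expand p) Ψ := eq_coeffMap_expand hDP
  -- `P` has degree at most `(D + 1) + (dim V - 1)`, which is less than `(D + 1) p` as `p ≥ 2` and
  -- `2 dim V ≤ p`. Untwisting divides degrees by `p` and leaves at most `D`.
  have hΨdeg : Ψ ∈ degLE k B (Pos n) k D := by
    have h1 : Θ' ∈ degLE k B (Pos n) k (Module.finrank k V - 1) :=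
      degFil_le_degLE hE (expRepInv_mem_degFil hE hEφ genericMatrix_mem_degBand)
    refine degLE_mono ?_ (lTensor_contract_mem_degLE (p := p) (degLE_mul_mem hD h1))
    refine Nat.lt_succ_iff.1 ((Nat.div_lt_iff_lt_mul hp.out.pos).2 ?_)
    have h2 : D.succ * p = D * p + p := by rw [Nat.succ_mul]
    have h3 : D * 2 ≤ D * p := Nat.mul_le_mul_left _ hp2
    omega
  clear_value Ψ P
  let Δ := coeffMap B (comul k n)
  let ι₁ := coeffMap B (inclLeft k n)
  let ι₂ := coeffMap B (inclRight k n)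
  -- In group terms `P(gh) Θ(g) = Φ(g) P(h)`, obtained from multiplicativity of `Φ = P Θ` and of `Θ`
  -- by cancelling `Θ(h)`.
  have hkey : Δ P * ι₁ Θ = ι₁ Φ * ι₂ P := by
    have h1 : Δ P * (ι₁ Θ * ι₂ Θ) = ι₁ Φ * (ι₂ P * ι₂ Θ) := by
      rw [← map_mul ι₂, hPΘ, ← hΘ.comul_eq, ← hΦ.comul_eq, ← map_mul, hPΘ]
    have h2 := congrArg (fun x => x * ι₂ Θ') h1
    simp only [mul_assoc] at h2
    rwa [← map_mul ι₂, hΘΘ', map_one, mul_one, mul_one] at h2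
  -- The relation `hkey` is differentiated in `g` along `X` and evaluated at `g = 1`. The derivative
  -- of `P(gh)` vanishes because it depends on `p`-th powers only, and what remains is `P(h) φ(X) =
  -- φ(X) P(h)`.
  have hcomm : ∀ X, Commute (φ X ⊗ₜ[k] (1 : CoordRing k n)) P := by
    intro X
    have h1 : (derivLeft (invDeriv X.1) : _ →ₗ[k] CoordRing k n ⊗[k] CoordRing k n).lTensor B
        (Δ P) = 0 := by
      rw [hPΨ, coeffMap_coeffMap, coeffMap_apply, lTensor_lTensor]
      refine (lTensor_congr (g := 0) (fun a => ?_) Ψ).trans ?_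
      · change derivLeft (invDeriv X.1) (comul k n (expand p a)) = 0
        rw [comul_expand]
        induction comul k n a with
        | zero => simp
        | add x y hx hy => rw [map_add, map_add, hx, hy, add_zero]
        | tmul b c => simp [derivation_expand]
      · rw [LinearMap.lTensor_zero, LinearMap.zero_apply]
    have h2 := congrArg ((derivLeft (invDeriv X.1) :
      _ →ₗ[k] CoordRing k n ⊗[k] CoordRing k n).lTensor B) hkey
    rw [lTensor_derivation_mul, lTensor_derivation_mul, h1, zero_mul, zero_add,
      lTensor_derivLeft_inclLeft, lTensor_derivLeft_inclLeft, lTensor_derivLeft_inclRight,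
      mul_zero, add_zero] at h2
    have h3 := congrArg (coeffMap B (projRight k n)) h2
    have h4 : coeffMap B (projRight k n) (Δ P) = P := by
      rw [coeffMap_coeffMap]
      have : (projRight k n).comp (comul k n) = AlgHom.id k _ := AlgHom.ext projRight_comul
      rw [this]
      exact DFunLike.congr_fun (Algebra.TensorProduct.map_id) _
    rw [map_mul, map_mul, h4, projRight_inclLeft, projRight_inclLeft, projRight_inclRight] at h3
    have h5 : evalOne k n B ((invDeriv X.1 : CoordRing k n →ₗ[k] CoordRing k n).lTensor B Θ) =
        φ X := differential_expRep hE hEφ hd' hn X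
    rw [h5] at h3
    exact h3.symm
  have hPrep : IsRepElement P := by
    refine ⟨?_, ?_⟩
    -- Once `Θ(g)` commutes with `P(h)`, `hkey` reads `P(gh) Θ(g) = P(g) P(h) Θ(g)`, and `Θ(g)` is
    -- cancelled.
    · have h1 : Commute (ι₁ Θ) (ι₂ P) := by
        change Commute (coeffMap B (inclLeft k n) (expRep p φ (generic k n))) _
        rw [coeffMap_expRep]
        refine commute_expRep (fun X => ?_) _
        have := (hcomm X).map ι₂
        simpa [ι₂, Algebra.TensorProduct.one_def] using this
      have h2 : Δ P * ι₁ Θ = ι₁ P * ι₂ P * ι₁ Θ := by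
        rw [hkey, ← hPΘ, map_mul, mul_assoc, mul_assoc, h1.eq]
      have h3 := congrArg (fun x => x * ι₁ Θ') h2
      simp only [mul_assoc] at h3
      rwa [← map_mul ι₁, hΘΘ', map_one, mul_one, mul_one] at h3
    · have := congrArg (evalOne k n B) hPΘ
      rwa [map_mul, hΘ.evalOne_eq, mul_one, hΦ.evalOne_eq] at this
  refine ⟨Ψ, hΨdeg, ?_, ?_, fun X => ?_⟩
  · rw [hPΨ] at hPrep
    exact isRepElement_coeffMap_expand.1 hPrep
  · rw [← hPΨ, (commute_expRep hcomm (generic k n)).eq, hPΘ]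
  · have := intertwines_of_commute (hcomm X)
    rw [hPΨ] at this
    exact intertwines_of_lTensor (h := (expand p : CoordRing k n →ₐ[k] _).toLinearMap)
      (expand_injective hp.out.pos) this

/-- Induction on the degree bound: each Frobenius quotient lowers it by one and contributes one
factor. In degree zero a representation is constant, equal to its value `1` at the identity. -/
theorem exists_expProd (hn : n ≤ p) (hd : 2 * Module.finrank k V ≤ p) (l : ℕ)
    {Φ : Module.End k V ⊗[k] CoordRing k n} (hΦ : IsRepElement Φ)
    (hD : Φ ∈ degLE k (Module.End k V) (Pos n) k l) :
    ∃ φ : Fin l → (strictUpper k n →ₗ⁅k⁆ Module.End k V), (∀ i X, IsNilpotent (φ i X)) ∧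
      (∀ i j, i ≠ j → ∀ X Y, Commute (φ i X) (φ j Y)) ∧ Φ = expProd p φ := by
  induction l generalizing Φ with
  | zero =>
    refine ⟨fun i => i.elim0, fun i => i.elim0, fun i => i.elim0, ?_⟩
    rw [eq_tmul_one_of_mem_degLE_zero hD, hΦ.evalOne_eq]
    simp [expProd, Algebra.TensorProduct.one_def]
  | succ l ih =>
    obtain ⟨Ψ, hΨD, hΨ, hΦΨ, hcomm⟩ := exists_frobenius_quotient hn hd hΦ hD
    obtain ⟨φ', hnil, hc, hΨφ⟩ := ih hΨ hΨD
    have hd' : Module.finrank k V ≤ p := by omega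
    -- The operator `φ_0(X)` is an endomorphism of the representation `Ψ`, so it commutes with all
    -- the Lie homomorphisms in the decomposition of `Ψ`.
    have h0 : ∀ X j Y, Commute (differentialHom hΦ X) (φ' j Y) := by
      intro X j Y
      have h1 := hcomm X
      rw [hΨφ] at h1
      exact comp_eq_of_intertwines_expProd hn hd' hd' hnil hnil h1 j Y
    refine ⟨Fin.cons (differentialHom hΦ) φ', fun i => ?_, fun i j hij X Y => ?_, ?_⟩
    · refine Fin.cases (fun X => ?_) (fun j => ?_) i
      · exact ⟨p, differential_pow_char hn hΦ X⟩
      · exact hnil j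
    · induction i using Fin.cases with
      | zero =>
        induction j using Fin.cases with
        | zero => exact absurd rfl hij
        | succ j => exact h0 X j Y
      | succ i =>
        induction j using Fin.cases with
        | zero => exact (h0 Y i X).symm
        | succ j => exact hc i j (fun h => hij (congrArg Fin.succ h)) X Y
    · rw [expProd_succ]
      simpa [← hΨφ] using hΦΨ

end Decomposition

end UnipotentRep

theorem mainTheorem5 {k V W : Type*} [Field k] [AddCommGroup V] [Module k V]
    [AddCommGroup W] [Module k W] [FiniteDimensional k V] [FiniteDimensional k W]
    (p n d : ℕ) [Fact p.Prime] [CharP k p] (hp : max n (2 * d) ≤ p)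
    (hV : Module.finrank k V ≤ d) (hW : Module.finrank k W ≤ d)
    (Φ : V →ₗ[k] V ⊗[k] UnipotentRep.CoordRing k n)
    (Ψ : W →ₗ[k] W ⊗[k] UnipotentRep.CoordRing k n)
    (hΦ : UnipotentRep.IsRepresentation Φ) (hΨ : UnipotentRep.IsRepresentation Ψ) :
    (∃ (m : ℕ) (φ : Fin (m + 1) → (UnipotentRep.strictUpper k n →ₗ⁅k⁆ Module.End k V))
        (ψ : Fin (m + 1) → (UnipotentRep.strictUpper k n →ₗ⁅k⁆ Module.End k W)),
      UnipotentRep.IsDecomposition p φ Φ ∧ UnipotentRep.IsDecomposition p ψ Ψ) ∧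
    ∀ (m : ℕ) (φ : Fin (m + 1) → (UnipotentRep.strictUpper k n →ₗ⁅k⁆ Module.End k V))
      (ψ : Fin (m + 1) → (UnipotentRep.strictUpper k n →ₗ⁅k⁆ Module.End k W)),
      UnipotentRep.IsDecomposition p φ Φ → UnipotentRep.IsDecomposition p ψ Ψ →
      (∀ i, UnipotentRep.IsRepresentation (UnipotentRep.toCoaction (UnipotentRep.factor p φ i)) ∧
        UnipotentRep.IsRepresentation (UnipotentRep.toCoaction (UnipotentRep.factor p ψ i))) ∧
      ∀ f : V →ₗ[k] W, UnipotentRep.IsMorphism f Φ Ψ ↔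
        ∀ i, UnipotentRep.IsMorphism f (UnipotentRep.toCoaction (UnipotentRep.factor p φ i))
          (UnipotentRep.toCoaction (UnipotentRep.factor p ψ i)) := by
  have hn : n ≤ p := (le_max_left _ _).trans hp
  have h2d : 2 * d ≤ p := (le_max_right _ _).trans hp
  have hV' : Module.finrank k V ≤ p := by omega
  have hW' : Module.finrank k W ≤ p := by omega
  refine ⟨?_, ?_⟩
  · obtain ⟨Θ, rfl⟩ := UnipotentRep.coact_surjective Φ
    obtain ⟨Ξ, rfl⟩ := UnipotentRep.coact_surjective Ψ
    have hΘ := UnipotentRep.isRepresentation_iff.1 hΦ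
    have hΞ := UnipotentRep.isRepresentation_iff.1 hΨ
    obtain ⟨D, hD⟩ := UnipotentRep.exists_mem_degLE Θ
    obtain ⟨D', hD'⟩ := UnipotentRep.exists_mem_degLE Ξ
    -- A common degree bound gives both decompositions the same length; the added `1` makes the
    -- number of factors of the form `m + 1`.
    obtain ⟨φ, hφ, hφc, hφp⟩ := UnipotentRep.exists_expProd hn (by omega) (max D D' + 1) hΘ
      (UnipotentRep.degLE_mono (by omega) hD)
    obtain ⟨ψ, hψ, hψc, hψp⟩ := UnipotentRep.exists_expProd hn (by omega) (max D D' + 1) hΞ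
      (UnipotentRep.degLE_mono (by omega) hD')
    refine ⟨max D D', φ, ψ, ⟨hφ, hφc, ?_⟩, ⟨hψ, hψc, ?_⟩⟩
    · rw [UnipotentRep.prod_factor_eq hn hV' hφ, ← hφp]
      rfl
    · rw [UnipotentRep.prod_factor_eq hn hW' hψ, ← hψp]
      rfl
  · intro m φ ψ hφ hψ
    refine ⟨fun i => ⟨UnipotentRep.isRepresentation_iff.2
      (UnipotentRep.isRepElement_factor hn hV' i (hφ.nilpotent i)),
      UnipotentRep.isRepresentation_iff.2
        (UnipotentRep.isRepElement_factor hn hW' i (hψ.nilpotent i))⟩, fun f => ?_⟩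
    rw [hφ.eq_prod, hψ.eq_prod, UnipotentRep.isMorphism_iff_intertwines]
    simp only [UnipotentRep.isMorphism_iff_intertwines]
    refine ⟨fun h i => ?_, UnipotentRep.intertwines_prod⟩
    rw [UnipotentRep.prod_factor_eq hn hV' hφ.nilpotent,
      UnipotentRep.prod_factor_eq hn hW' hψ.nilpotent] at h
    exact UnipotentRep.intertwines_factor hn hV' hW' hφ.nilpotent hψ.nilpotent i
      (UnipotentRep.comp_eq_of_intertwines_expProd hn hV' hW' hφ.nilpotent hψ.nilpotent h i)
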